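/- Let $X\subseteq\mathbb R^d$ be closed and convex, let $\xi$ be a random element of a measurable space $\Xi$ with law $P$, let $f(x)=\mathbb E_\xi[\tilde f(x,\xi)]$ be differentiable, let $c=(c_1,\dots,c_m):\mathbb R^d\to\mathbb R^m$ be deterministic and differentiable, and consider $$\min_{x\in X} f(x)\quad\text{subject to } c(x)=0 .$$ Let $\tilde\nabla f(x,\xi)$ be an unbiased oracle, $\mathbb E_\xi[\tilde\nabla f(x,\xi)]=\nabla f(x)$, and write $\nabla c(x)^\top v=\sum_i v_i\nabla c_i(x)$, $Q_\rho(x)=f(x)+\frac{\rho}{2}\|c(x)\|^2$, $\tilde\nabla Q_\rho(x,\xi)=\tilde\nabla f(x,\xi)+\rho\,\nabla c(x)^\top c(x)$, $N_X(x)$ for the normal cone of $X$ at $x$, $P_X$ for the projection onto $X$ and $\mathsf d$ for the Euclidean distance to a set. Algorithm. Given $x_1\in X$, i.i.d. samples $\xi_1,\xi_2,\dots\sim P$ and $g_1=\tilde\nabla Q_{\rho_1}(x_1,\xi_1)$, for $k=1,2,\dots$ put $$x_{k+1}=P_X(x_k-\eta_kg_k),\qquad g_{k+1}=\tilde\nabla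 Q_{\rho_{k+1}}(x_{k+1},\xi_{k+1})+(1-\alpha_{k+1})\bigl(g_k-\tilde\nabla Q_{\rho_k}(x_k,\xi_{k+1})\bigr).$$ Assumptions. There are constants $L_{\nabla f},L_{\nabla c},L_c,\sigma_f,C_{\nabla c},C_c,B_f,C_{\nabla f}\ge0$, $\underline Q\in\mathbb R$ and $\delta>0$ such that for all $x,y\in X$ and all $i\in\{1,\dots,m\}$: - $\mathbb E_\xi\|\tilde\nabla f(x,\xi)-\tilde\nabla f(y,\xi)\|^2\le L_{\nabla f}^2\|x-y\|^2$, $\ \|\nabla c_i(x)-\nabla c_i(y)\|\le L_{\nabla c}\|x-y\|$, $\ |c_i(x)-c_i(y)|\le L_c\|x-y\|$; - $\mathbb E_\xi\|\tilde\nabla f(x,\xi)-\nabla f(x)\|^2\le\sigma_f^2$; - $\|\nabla c_i(x)\|\le C_{\nabla c}$, $\ |c_i(x)|\le C_c$, $\ \|\nabla f(x)\|\le C_{\nabla f}$, and $Q_r(x)\ge\underline Q$ for all $r>0$; - for every $k\ge1$, almost surely, $|f(x_k)|\le B_f$ and $\mathsf d(\nabla c(x_k)^\top c(x_k),-N_X(x_k))\ge\delta\|c(x_k)\|$.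 Let $\tilde L\ge 0$ be defined by $\tilde L^2=4L_{\nabla f}^2+4m^2(C_c^2L_{\nabla c}^2+C_{\nabla c}^2L_c^2)$, suppose $\tilde L>0$, let $\rho>1$, and run the algorithm with $$\eta_k=\frac1{9\tilde L\rho(k+1)^{1/2}},\qquad \rho_k=\rho k^{1/4},\qquad \alpha_{k+1}=\frac{72}{81(k+1)^{1/2}} .$$ Then there are constants $C$ and $q\in\mathbb N$, depending only on $m$, $\rho$ and the constants of the assumptions, such that for every $\varepsilon\in(0,1]$ there is an integer $K_0\ge1$ with $$K_0\le C\,\varepsilon^{-4}\,(1+\log(1/\varepsilon))^{q}$$ (that is, $K_0=\widetilde O(\varepsilon^{-4})$) for which the following holds. For every $K\ge K_0$, if $\hat k$ is uniform on $\{1,\dots,K\}$ and independent of the samples, then $x_{\hat k+1}\in X$ is an $\varepsilon$-stationary point in expectation: there is a random vector $\lambda\in\mathbb R^m$ such that $$\mathbb E\,\mathsf d\bigl(\nabla f(x_{\hat k+1})+\nabla c(x_{\hat k+1})^\top\lambda,\,-N_X(x_{\hat k+1})\bigr)\le\varepsilon\qquad\text{and}\qquad \mathbb E\|c(x_{\hat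 k+1})\|\le\varepsilon .$$ -/

import Mathlib

open MeasureTheory ProbabilityTheory
open scoped Pointwise

noncomputable section

namespace StochPenalty

/-- `ℝⁿ` with the Euclidean norm. -/
abbrev Vec (n : ℕ) := EuclideanSpace ℝ (Fin n)

/-- The normal cone `N_X(x)` of a convex set `X` at a point `x ∈ X`. -/
def normalCone {d : ℕ} (X : Set (Vec d)) (x : Vec d) : Set (Vec d) :=
  {v | ∀ y ∈ X, inner ℝ v (y - x) ≤ 0}

/-- The metric projection `P_X(u)`: the nearest point of `X` to `u` (it exists and is unique
when `X` is nonempty, closed and convex). -/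
def proj {d : ℕ} (X : Set (Vec d)) (u : Vec d) : Vec d :=
  Classical.epsilon fun y => y ∈ X ∧ ∀ z ∈ X, ‖u - y‖ ≤ ‖u - z‖

/-- The data of the problem `min_{x ∈ X} E[f̃(x, ξ)]` subject to `c(x) = 0`, with `ξ ∼ P` and with
a stochastic gradient oracle for the objective. -/
structure Problem (d m : ℕ) (Ξ : Type*) [MeasurableSpace Ξ] where
  /-- the simple constraint set -/
  X : Set (Vec d)
  /-- the distribution of the samples -/
  P : Measure Ξ
  /-- the stochastic objective `f̃(x, ξ)` -/
  fTilde : Vec d → Ξ → ℝ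
  /-- the stochastic gradient oracle `∇̃f(x, ξ)` -/
  gradOracle : Vec d → Ξ → Vec d
  /-- the deterministic constraint function -/
  c : Vec d → Vec m

/-- The constants that appear in the assumptions. -/
structure Constants where
  Lgf : ℝ
  Lgc : ℝ
  Lc : ℝ
  σf : ℝ
  Cgc : ℝ
  Cc : ℝ
  Bf : ℝ
  Cgf : ℝ
  Qlow : ℝ
  δ : ℝ
  Lgf_nonneg : 0 ≤ Lgf
  Lgc_nonneg : 0 ≤ Lgc
  Lc_nonneg : 0 ≤ Lc
  σf_nonneg : 0 ≤ σf
  Cgc_nonneg : 0 ≤ Cgc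
  Cc_nonneg : 0 ≤ Cc
  Bf_nonneg : 0 ≤ Bf
  Cgf_nonneg : 0 ≤ Cgf
  δ_pos : 0 < δ

/-- `L̃`, where `L̃² = 4 L_{∇f}² + 4 m² (C_c² L_{∇c}² + C_{∇c}² L_c²)`. -/
def Constants.Ltilde (κ : Constants) (m : ℕ) : ℝ :=
  Real.sqrt (4 * κ.Lgf ^ 2 + 4 * (m : ℝ) ^ 2 * (κ.Cc ^ 2 * κ.Lgc ^ 2 + κ.Cgc ^ 2 * κ.Lc ^ 2))

namespace Problem

variable {d m : ℕ} {Ξ : Type*} [MeasurableSpace Ξ]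

/-- The objective `f(x) = E[f̃(x, ξ)]`. -/
def f (p : Problem d m Ξ) (x : Vec d) : ℝ := ∫ ξ, p.fTilde x ξ ∂p.P

/-- The gradient `∇c_i(x)` of the `i`-th constraint. -/
def gradC (p : Problem d m Ξ) (i : Fin m) (x : Vec d) : Vec d := gradient (fun y => p.c y i) x

/-- The transposed Jacobian applied to a vector: `∇c(x)ᵀ v = ∑ᵢ vᵢ ∇c_i(x)`. -/
def jacT (p : Problem d m Ξ) (x : Vec d) (v : Vec m) : Vec d := ∑ i, v i • p.gradC i x

/-- The quadratic penalty function `Q_ρ(x) = f(x) + (ρ/2) ∑ᵢ c_i(x)²`. -/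
def Q (p : Problem d m Ξ) (ρ : ℝ) (x : Vec d) : ℝ := p.f x + ρ / 2 * ∑ i, p.c x i ^ 2

/-- The stochastic gradient of the penalty function,
`∇̃Q_ρ(x, ξ) = ∇̃f(x, ξ) + ρ ∑ᵢ c_i(x) ∇c_i(x)`. -/
def oracleQ (p : Problem d m Ξ) (ρ : ℝ) (x : Vec d) (ξ : Ξ) : Vec d :=
  p.gradOracle x ξ + ρ • p.jacT x (p.c x)

/-- The stochastic linearized quadratic penalty method with variance reduction, for step sizes
`η k`, penalty parameters `r k`, momentum parameters `α k`, starting point `x₁` and samples `ξ k`.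
The value at `k ≥ 1` is the pair `(x_k, g_k)`; the value at `0` is a dummy that is never used. -/
def run (p : Problem d m Ξ) (η r α : ℕ → ℝ) (x₁ : Vec d) (ξ : ℕ → Ξ) : ℕ → Vec d × Vec d
  | 0 => (x₁, p.oracleQ (r 1) x₁ (ξ 1))
  | 1 => (x₁, p.oracleQ (r 1) x₁ (ξ 1))
  | k + 2 =>
    let x := (run p η r α x₁ ξ (k + 1)).1
    let g := (run p η r α x₁ ξ (k + 1)).2
    let x' := proj p.X (x - η (k + 1) • g)
    (x', p.oracleQ (r (k + 2)) x' (ξ (k + 2))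
      + (1 - α (k + 2)) • (g - p.oracleQ (r (k + 1)) x (ξ (k + 2))))

/-- The assumptions on the problem. The bounds on `c` and on its Jacobian are imposed
componentwise, and only on `X`; bounds with the same constants on the norm of the vector `c(x)` and
on the operator or Frobenius norm of the Jacobian, or on the whole space, are stronger. -/
structure Assumptions (p : Problem d m Ξ) (κ : Constants) : Prop where
  prob : IsProbabilityMeasure p.P
  closed : IsClosed p.X
  convex : Convex ℝ p.X
  integrable_f : ∀ x, Integrable (p.fTilde x) p.P
  diff_f : Differentiable ℝ p.f
  diff_c : Differentiable ℝ p.c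
  measurable_oracle : Measurable (Function.uncurry p.gradOracle)
  integrable_oracle : ∀ x ∈ p.X, Integrable (p.gradOracle x) p.P
  unbiased : ∀ x ∈ p.X, ∫ ξ, p.gradOracle x ξ ∂p.P = gradient p.f x
  smooth_f : ∀ x ∈ p.X, ∀ y ∈ p.X,
    ∫⁻ ξ, ‖p.gradOracle x ξ - p.gradOracle y ξ‖ₑ ^ 2 ∂p.P
      ≤ ENNReal.ofReal (κ.Lgf ^ 2 * ‖x - y‖ ^ 2)
  smooth_c : ∀ x ∈ p.X, ∀ y ∈ p.X, ∀ i, ‖p.gradC i x - p.gradC i y‖ ≤ κ.Lgc * ‖x - y‖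
  lipschitz_c : ∀ x ∈ p.X, ∀ y ∈ p.X, ∀ i, |p.c x i - p.c y i| ≤ κ.Lc * ‖x - y‖
  variance : ∀ x ∈ p.X,
    ∫⁻ ξ, ‖p.gradOracle x ξ - gradient p.f x‖ₑ ^ 2 ∂p.P ≤ ENNReal.ofReal (κ.σf ^ 2)
  bound_gradC : ∀ x ∈ p.X, ∀ i, ‖p.gradC i x‖ ≤ κ.Cgc
  bound_c : ∀ x ∈ p.X, ∀ i, |p.c x i| ≤ κ.Cc
  bound_gradf : ∀ x ∈ p.X, ‖gradient p.f x‖ ≤ κ.Cgf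
  bound_Q : ∀ ρ : ℝ, 0 < ρ → ∀ x ∈ p.X, κ.Qlow ≤ p.Q ρ x

/-- The assumptions along a random sequence of iterates `x_1, x_2, …`: boundedness of the objective
and the regularity condition `d(∇c(x_k)ᵀ c(x_k), -N_X(x_k)) ≥ δ ‖c(x_k)‖`. -/
structure IterateAssumptions (p : Problem d m Ξ) (κ : Constants) {Ω : Type*} [MeasurableSpace Ω]
    (μ : Measure Ω) (x : ℕ → Ω → Vec d) : Prop where
  bound_f : ∀ k, 1 ≤ k → ∀ᵐ ω ∂μ, |p.f (x k ω)| ≤ κ.Bf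
  regular : ∀ k, 1 ≤ k → ∀ᵐ ω ∂μ,
    κ.δ * ‖p.c (x k ω)‖ ≤ Metric.infDist (p.jacT (x k ω) (p.c (x k ω))) (-normalCone p.X (x k ω))

/-- `xbar` is an `ε`-stationary point in expectation: for some random multiplier `lam`, both
`E d(∇f(xbar) + ∇c(xbar)ᵀ lam, -N_X(xbar))` and `E ‖c(xbar)‖` exist and are at most `ε`. -/
def IsExpectedStationary (p : Problem d m Ξ) {Ω : Type*} [MeasurableSpace Ω] (μ : Measure Ω)
    (ε : ℝ) (xbar : Ω → Vec d) : Prop :=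
  (∀ ω, xbar ω ∈ p.X) ∧
  (∃ lam : Ω → Vec m, Measurable lam ∧
    Integrable (fun ω => Metric.infDist (gradient p.f (xbar ω) + p.jacT (xbar ω) (lam ω))
      (-normalCone p.X (xbar ω))) μ ∧
    ∫ ω, Metric.infDist (gradient p.f (xbar ω) + p.jacT (xbar ω) (lam ω))
      (-normalCone p.X (xbar ω)) ∂μ ≤ ε) ∧
  Integrable (fun ω => ‖p.c (xbar ω)‖) μ ∧ ∫ ω, ‖p.c (xbar ω)‖ ∂μ ≤ ε

end Problem

/-- `η_k = 1 / (9 L̃ ρ (k+1)^{1/2})`. -/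
def stepSize (L ρ : ℝ) (k : ℕ) : ℝ := 1 / (9 * L * ρ * ((k : ℝ) + 1) ^ (1 / 2 : ℝ))

/-- `ρ_k = ρ k^{1/4}`. -/
def penalty (ρ : ℝ) (k : ℕ) : ℝ := ρ * (k : ℝ) ^ (1 / 4 : ℝ)

/-- `α_k = 72 / (81 k^{1/2})`, that is, `α_{k+1} = 72 / (81 (k+1)^{1/2})`. -/
def momentum (k : ℕ) : ℝ := 72 / (81 * (k : ℝ) ^ (1 / 2 : ℝ))

/-- The iterate `x_k` of the method with the parameters above. -/
def iterate {d m : ℕ} {Ξ : Type*} [MeasurableSpace Ξ] (p : Problem d m Ξ) (κ : Constants) (ρ : ℝ)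
    (x₁ : Vec d) (ξ : ℕ → Ξ) (k : ℕ) : Vec d :=
  (p.run (stepSize (κ.Ltilde m) ρ) (penalty ρ) momentum x₁ ξ k).1

end StochPenalty

end

/-! The multiplier is `λ = ρ_k c(x_{k+1})`, at the random index `k = kHat`. With it, `∇f + ∇cᵀλ` at
`x_{k+1}` is the gradient of `Q_{ρ_k}`. It therefore suffices to make the expected gap `S_k =
d(∇Q_{ρ_k}(x_{k+1}), -N_X(x_{k+1}))` small on average. Feasibility then follows from regularity:
normal cones are cones, so `δ ρ_k ‖c(x_{k+1})‖ ≤ S_k + C_{∇f}`, and `ρ_k` grows like `k^{1/4}`.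

The gaps are summed with the potential `E Q_{ρ_k}(x_k) + E‖e_k‖² / (8 L̃ ρ)`, where `e_k = g_k -
∇Q_{ρ_k}(x_k)`. Three effects balance. (1) A projected step lowers `Q_{ρ_k}` by `η_k S_k² / 8 +
‖x_{k+1} - x_k‖² / (144 η_k)` up to an error `η_k ‖e_k‖²` (`Q_proj_add_le`). (2) The penalty part of
the oracle is deterministic and cancels from `e_k`. So `E‖e_k‖²` contracts by `(1 - α_{k+1})²`, up
to a term in `L_{∇f}² E‖x_{k+1} - x_k‖²` and a term in `α_{k+1}² σ_f²`, neither of which contains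
the growing `ρ_k` (`lintegral_gradErr_succ_le`). As `α_{k+1} = 8 L̃ ρ η_k`, the contraction pays for
the error in (1), and the movement term of (1) pays for the one here. (3) Raising the penalty costs
`(ρ_{k+1} - ρ_k)/2 · ‖c(x_{k+1})‖²`. By regularity `‖c‖²` is of order `(S_k² + C_{∇f}²)/ρ_k²`, so
the cost is of order `k^{-5/4}(S_k² + C_{∇f}²)`; half of the gain in `S_k²` absorbs it, up to
`O(1/k)` (`penalty_growth_le`).

All remaining errors are `O(1/k)` and the potential has bounded range, so telescoping gives `∑ η_k E
S_k² = O(1 + log K)`. Since `η_k` is of order at least `K^{-1/2}` for `k ≤ K`, the average of `E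
S_k²` is `O((1 + log K)/√K)` (`sum_integral_statGap_sq_le`). This is at most a multiple of `ε²` once
`K` exceeds a multiple of `ε⁻⁴ (1 + log (1/ε))²` (`exists_threshold`). -/

namespace StochPenalty

/-! ### Projections, normal cones, and measurability of the distance to a normal cone. -/

section Geometry

variable {d : ℕ} {X : Set (Vec d)}

theorem proj_spec (hne : X.Nonempty) (hcl : IsClosed X) (u : Vec d) :
    proj X u ∈ X ∧ ∀ z ∈ X, ‖u - proj X u‖ ≤ ‖u - z‖ := by
  obtain ⟨y, hy, h⟩ := hcl.exists_infDist_eq_dist hne u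
  refine Classical.epsilon_spec (p := fun y => y ∈ X ∧ ∀ z ∈ X, ‖u - y‖ ≤ ‖u - z‖)
    ⟨y, hy, fun z hz => ?_⟩
  rw [← dist_eq_norm, ← dist_eq_norm, ← h]
  exact Metric.infDist_le_dist_of_mem hz

theorem proj_mem (hne : X.Nonempty) (hcl : IsClosed X) (u : Vec d) : proj X u ∈ X :=
  (proj_spec hne hcl u).1

/-- The variational inequality that characterizes the projection. -/
theorem sub_proj_mem_normalCone (hne : X.Nonempty) (hcl : IsClosed X) (hconv : Convex ℝ X)
    (u : Vec d) : u - proj X u ∈ normalCone X (proj X u) := by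
  obtain ⟨hm, hmin⟩ := proj_spec hne hcl u
  refine (norm_eq_iInf_iff_real_inner_le_zero hconv hm).1 ?_
  have : Nonempty X := hne.to_subtype
  refine le_antisymm (le_ciInf fun w => hmin w w.2) ?_
  exact ciInf_le (f := fun w : X => ‖u - w‖)
    ⟨0, by rintro _ ⟨w, rfl⟩; exact norm_nonneg _⟩ ⟨proj X u, hm⟩

theorem norm_proj_sub_proj_le (hne : X.Nonempty) (hcl : IsClosed X) (hconv : Convex ℝ X)
    (u v : Vec d) : ‖proj X u - proj X v‖ ≤ ‖u - v‖ := by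
  have h1 := sub_proj_mem_normalCone hne hcl hconv u _ (proj_mem hne hcl v)
  have h2 := sub_proj_mem_normalCone hne hcl hconv v _ (proj_mem hne hcl u)
  set a := proj X u
  set b := proj X v
  have h3 : inner ℝ (u - a) (b - a) + inner ℝ (v - b) (a - b)
      = ‖a - b‖ ^ 2 - inner ℝ (u - v) (a - b) := by
    rw [← real_inner_self_eq_norm_sq]
    simp only [inner_sub_left, inner_sub_right]
    ring
  have h4 := real_inner_le_norm (u - v) (a - b)
  have h5 : ‖a - b‖ * ‖a - b‖ ≤ ‖u - v‖ * ‖a - b‖ := by nlinarith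
  rcases (norm_nonneg (a - b)).eq_or_lt with h | h
  · rw [← h]; exact norm_nonneg _
  · exact le_of_mul_le_mul_right h5 h

theorem continuous_proj (hne : X.Nonempty) (hcl : IsClosed X) (hconv : Convex ℝ X) :
    Continuous (proj X) := by
  refine (LipschitzWith.of_dist_le_mul (K := 1) fun u v => ?_).continuous
  simpa [dist_eq_norm] using norm_proj_sub_proj_le hne hcl hconv u v

theorem zero_mem_neg_normalCone (x : Vec d) : (0 : Vec d) ∈ -normalCone X x := by
  simp [normalCone]

theorem smul_mem_neg_normalCone {x v : Vec d} {r : ℝ} (hr : 0 ≤ r)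
    (hv : v ∈ -normalCone X x) : r • v ∈ -normalCone X x := by
  intro y hy
  have h := hv y hy
  rw [← smul_neg, real_inner_smul_left]
  exact mul_nonpos_of_nonneg_of_nonpos hr h

theorem isClosed_neg_normalCone (x : Vec d) : IsClosed (-normalCone X x) := by
  have : -normalCone X x = ⋂ y ∈ X, {v | inner ℝ (-v) (y - x) ≤ 0} := by
    ext v; simp [normalCone]
  rw [this]
  exact isClosed_biInter fun y _ => isClosed_le (by fun_prop) continuous_const

/-- The distance to a cone is positively homogeneous. -/
theorem mul_infDist_neg_normalCone_le {r : ℝ} (hr : 0 < r) (x v : Vec d) :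
    r * Metric.infDist v (-normalCone X x) ≤ Metric.infDist (r • v) (-normalCone X x) := by
  refine (Metric.le_infDist ⟨0, zero_mem_neg_normalCone x⟩).2 fun {w} hw => ?_
  have h := Metric.infDist_le_dist_of_mem (x := v)
    (smul_mem_neg_normalCone (inv_nonneg.2 hr.le) hw)
  calc r * Metric.infDist v (-normalCone X x) ≤ r * dist v (r⁻¹ • w) := by gcongr
    _ = dist (r • v) w := by
      rw [dist_eq_norm, dist_eq_norm, ← abs_of_pos hr, ← Real.norm_eq_abs, ← norm_smul, smul_sub,
        Real.norm_eq_abs, abs_of_pos hr, smul_smul, mul_inv_cancel₀ hr.ne', one_smul]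

/-- The normal cone has a closed graph. The distance is attained, so the set is the projection of a
closed set along a compact ball of displacements `w`, and such projections are closed maps.
Measurability of the stationarity gap rests on this. -/
theorem isClosed_setOf_infDist_neg_normalCone_le (hcl : IsClosed X) (t : ℝ) :
    IsClosed {q : Vec d × Vec d | q.2 ∈ X ∧ Metric.infDist q.1 (-normalCone X q.2) ≤ t} := by
  have key : {q : Vec d × Vec d | q.2 ∈ X ∧ Metric.infDist q.1 (-normalCone X q.2) ≤ t}
      = Prod.snd '' {z : Metric.closedBall (0 : Vec d) t × (Vec d × Vec d) |
          z.2.2 ∈ X ∧ ∀ y ∈ X, inner ℝ (-(z.2.1 + z.1)) (y - z.2.2) ≤ 0} := by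
    ext ⟨v, x⟩
    simp only [Set.mem_ofPred_eq, Set.mem_image, Prod.exists, Subtype.exists]
    constructor
    · rintro ⟨hx, h⟩
      obtain ⟨w, hw, hd⟩ := (isClosed_neg_normalCone (X := X) x).exists_infDist_eq_dist
        ⟨0, zero_mem_neg_normalCone x⟩ v
      refine ⟨w - v, ?_, v, x, ⟨hx, fun y hy => ?_⟩, rfl⟩
      · rw [mem_closedBall_zero_iff, ← dist_eq_norm, dist_comm, ← hd]; exact h
      · simpa using hw y hy
    · rintro ⟨w, hw, v', x', ⟨hx, h⟩, heq⟩
      simp only [Prod.mk.injEq] at heq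
      obtain ⟨rfl, rfl⟩ := heq
      have hm : v' + w ∈ -normalCone X x' := h
      refine ⟨hx, (Metric.infDist_le_dist_of_mem hm).trans ?_⟩
      simpa [dist_eq_norm] using hw
  rw [key]
  have : CompactSpace (Metric.closedBall (0 : Vec d) t) :=
    isCompact_iff_compactSpace.1 (isCompact_closedBall _ _)
  refine isClosedMap_snd_of_compactSpace _ ?_
  have heq : {z : Metric.closedBall (0 : Vec d) t × (Vec d × Vec d) |
      z.2.2 ∈ X ∧ ∀ y ∈ X, inner ℝ (-(z.2.1 + z.1)) (y - z.2.2) ≤ 0}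
      = {z | z.2.2 ∈ X} ∩ ⋂ y ∈ X, {z | inner ℝ (-(z.2.1 + (z.1 : Vec d))) (y - z.2.2) ≤ 0} := by
    ext z; simp
  rw [heq]
  refine (hcl.preimage (by fun_prop)).inter
    (isClosed_biInter fun y _ => isClosed_le (by fun_prop) continuous_const)

theorem measurable_infDist_neg_normalCone (hcl : IsClosed X) {Ω : Type*} [MeasurableSpace Ω]
    {v x : Ω → Vec d} (hv : Measurable v) (hx : Measurable x) (hxX : ∀ ω, x ω ∈ X) :
    Measurable fun ω => Metric.infDist (v ω) (-normalCone X (x ω)) := by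
  refine measurable_of_Iic fun t => ?_
  have : (fun ω => Metric.infDist (v ω) (-normalCone X (x ω))) ⁻¹' Set.Iic t
      = (fun ω => (v ω, x ω)) ⁻¹'
        {q : Vec d × Vec d | q.2 ∈ X ∧ Metric.infDist q.1 (-normalCone X q.2) ≤ t} := by
    ext ω; simp [hxX ω]
  rw [this]
  exact (hv.prodMk hx) (isClosed_setOf_infDist_neg_normalCone_le hcl t).measurableSet

end Geometry

/-! ### Second moments of random vectors. -/

section SecondMoments

variable {d : ℕ} {Ξ : Type*} [MeasurableSpace Ξ] {P : Measure Ξ}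

theorem memLp_two_of_lintegral_le {Z : Ξ → Vec d} (hZ : AEStronglyMeasurable Z P) {B : ℝ}
    (h : ∫⁻ ξ, ‖Z ξ‖ₑ ^ 2 ∂P ≤ ENNReal.ofReal B) : MemLp Z 2 P := by
  refine ⟨hZ, ?_⟩
  rw [eLpNorm_lt_top_iff_lintegral_rpow_enorm_lt_top two_ne_zero ENNReal.ofNat_ne_top]
  simpa using h.trans_lt ENNReal.ofReal_lt_top

theorem integrable_norm_sq {Z : Ξ → Vec d} (hZ : MemLp Z 2 P) :
    Integrable (fun ξ => ‖Z ξ‖ ^ 2) P :=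
  (memLp_two_iff_integrable_sq_norm hZ.1).1 hZ

theorem lintegral_enorm_sq_eq {Z : Ξ → Vec d} (hZ : MemLp Z 2 P) :
    ∫⁻ ξ, ‖Z ξ‖ₑ ^ 2 ∂P = ENNReal.ofReal (∫ ξ, ‖Z ξ‖ ^ 2 ∂P) := by
  rw [ofReal_integral_eq_lintegral_ofReal (integrable_norm_sq hZ)
    (ae_of_all _ fun ξ => by positivity)]
  refine lintegral_congr fun ξ => ?_
  rw [ENNReal.ofReal_pow (norm_nonneg _), ofReal_norm]

theorem integral_norm_sq_le {Z : Ξ → Vec d} (hZ : AEStronglyMeasurable Z P) {B : ℝ} (hB : 0 ≤ B)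
    (h : ∫⁻ ξ, ‖Z ξ‖ₑ ^ 2 ∂P ≤ ENNReal.ofReal B) : ∫ ξ, ‖Z ξ‖ ^ 2 ∂P ≤ B := by
  rw [lintegral_enorm_sq_eq (memLp_two_of_lintegral_le hZ h)] at h
  exact (ENNReal.ofReal_le_ofReal_iff hB).1 h

theorem integral_norm_add_sq [IsProbabilityMeasure P] {Z : Ξ → Vec d} (hZ : MemLp Z 2 P)
    (a : Vec d) :
    ∫ ξ, ‖a + Z ξ‖ ^ 2 ∂P = ‖a‖ ^ 2 + 2 * inner ℝ a (∫ ξ, Z ξ ∂P) + ∫ ξ, ‖Z ξ‖ ^ 2 ∂P := by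
  have hi : Integrable Z P := hZ.integrable (by norm_num)
  have h1 : Integrable (fun ξ => 2 * inner ℝ a (Z ξ)) P := (hi.const_inner a).const_mul 2
  simp_rw [norm_add_sq_real]
  have h2 : Integrable (fun ξ => ‖a‖ ^ 2 + 2 * inner ℝ a (Z ξ)) P := (integrable_const _).add h1
  rw [integral_add h2 (integrable_norm_sq hZ),
    integral_add (integrable_const _) h1, integral_const_mul, integral_inner hi]
  simp

/-- The variance is at most the second moment. -/
theorem integral_norm_sub_integral_sq_le [IsProbabilityMeasure P] {Z : Ξ → Vec d}
    (hZ : MemLp Z 2 P) :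
    ∫ ξ, ‖Z ξ - ∫ ζ, Z ζ ∂P‖ ^ 2 ∂P ≤ ∫ ξ, ‖Z ξ‖ ^ 2 ∂P := by
  have h := integral_norm_add_sq hZ (-∫ ζ, Z ζ ∂P)
  simp only [neg_add_eq_sub, norm_neg, inner_neg_left, real_inner_self_eq_norm_sq] at h
  rw [h]
  nlinarith [sq_nonneg ‖∫ ζ, Z ζ ∂P‖]

theorem norm_integral_sq_le [IsProbabilityMeasure P] {Z : Ξ → Vec d} (hZ : MemLp Z 2 P) :
    ‖∫ ζ, Z ζ ∂P‖ ^ 2 ≤ ∫ ξ, ‖Z ξ‖ ^ 2 ∂P := by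
  have h := integral_norm_add_sq hZ (-∫ ζ, Z ζ ∂P)
  simp only [neg_add_eq_sub, norm_neg, inner_neg_left, real_inner_self_eq_norm_sq] at h
  have h0 : 0 ≤ ∫ ξ, ‖Z ξ - ∫ ζ, Z ζ ∂P‖ ^ 2 ∂P := integral_nonneg fun ξ => by positivity
  linarith

end SecondMoments

/-! ### Smoothness of the penalty function and the variance of one momentum step. -/

namespace Problem

variable {d m : ℕ} {Ξ : Type*} [MeasurableSpace Ξ] {p : Problem d m Ξ} {κ : Constants}

/-- The gradient `∇Q_r(x) = ∇f(x) + r ∇c(x)ᵀ c(x)` of the penalty function. -/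
noncomputable def gradQ (p : Problem d m Ξ) (r : ℝ) (x : Vec d) : Vec d :=
  gradient p.f x + r • p.jacT x (p.c x)

theorem oracleQ_sub_gradQ (r : ℝ) (x : Vec d) (ξ : Ξ) :
    p.oracleQ r x ξ - p.gradQ r x = p.gradOracle x ξ - gradient p.f x := by
  simp [oracleQ, gradQ]

namespace Assumptions

theorem measurable_oracle_apply (h : p.Assumptions κ) (x : Vec d) : Measurable (p.gradOracle x) :=
  h.measurable_oracle.comp measurable_prodMk_left

theorem memLp_oracle_sub (h : p.Assumptions κ) {x y : Vec d} (hx : x ∈ p.X) (hy : y ∈ p.X) :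
    MemLp (fun ξ => p.gradOracle x ξ - p.gradOracle y ξ) 2 p.P :=
  memLp_two_of_lintegral_le
    ((h.measurable_oracle_apply x).sub (h.measurable_oracle_apply y)).aestronglyMeasurable
    (h.smooth_f x hx y hy)

theorem integral_oracle_sub_sq_le (h : p.Assumptions κ) {x y : Vec d} (hx : x ∈ p.X)
    (hy : y ∈ p.X) :
    ∫ ξ, ‖p.gradOracle x ξ - p.gradOracle y ξ‖ ^ 2 ∂p.P ≤ κ.Lgf ^ 2 * ‖x - y‖ ^ 2 :=
  integral_norm_sq_le (h.memLp_oracle_sub hx hy).1 (by positivity) (h.smooth_f x hx y hy)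

theorem integral_oracle_sub (h : p.Assumptions κ) {x y : Vec d} (hx : x ∈ p.X)
    (hy : y ∈ p.X) :
    ∫ ξ, (p.gradOracle x ξ - p.gradOracle y ξ) ∂p.P = gradient p.f x - gradient p.f y := by
  rw [integral_sub (h.integrable_oracle x hx) (h.integrable_oracle y hy), h.unbiased x hx,
    h.unbiased y hy]

/-- Mean-square smoothness of the unbiased oracle passes to its mean, because the squared norm of a
mean is at most the second moment. -/
theorem norm_gradf_sub_le (h : p.Assumptions κ) {x y : Vec d} (hx : x ∈ p.X) (hy : y ∈ p.X) :
    ‖gradient p.f x - gradient p.f y‖ ≤ κ.Lgf * ‖x - y‖ := by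
  have := h.prob
  have h1 := norm_integral_sq_le (h.memLp_oracle_sub hx hy)
  rw [h.integral_oracle_sub hx hy] at h1
  refine le_of_sq_le_sq ?_ (mul_nonneg κ.Lgf_nonneg (norm_nonneg _))
  rw [mul_pow]
  exact h1.trans (h.integral_oracle_sub_sq_le hx hy)

theorem memLp_noise (h : p.Assumptions κ) {x : Vec d} (hx : x ∈ p.X) :
    MemLp (fun ξ => p.gradOracle x ξ - gradient p.f x) 2 p.P :=
  memLp_two_of_lintegral_le
    ((h.measurable_oracle_apply x).sub measurable_const).aestronglyMeasurable
    (h.variance x hx)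

theorem integral_noise_sq_le (h : p.Assumptions κ) {x : Vec d} (hx : x ∈ p.X) :
    ∫ ξ, ‖p.gradOracle x ξ - gradient p.f x‖ ^ 2 ∂p.P ≤ κ.σf ^ 2 :=
  integral_norm_sq_le (h.memLp_noise hx).1 (by positivity) (h.variance x hx)

theorem integral_noise (h : p.Assumptions κ) {x : Vec d} (hx : x ∈ p.X) :
    ∫ ξ, (p.gradOracle x ξ - gradient p.f x) ∂p.P = 0 := by
  have := h.prob
  rw [integral_sub (h.integrable_oracle x hx) (integrable_const _), h.unbiased x hx]
  simp

/-- One step of the recursive momentum estimator: the second moment of the new error, conditionally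
on the past. -/
theorem lintegral_momentum_error_le (h : p.Assumptions κ) {x y : Vec d} (hx : x ∈ p.X)
    (hy : y ∈ p.X) {α : ℝ} (hα0 : 0 ≤ α) (hα1 : α ≤ 1) (b : Vec d) :
    ∫⁻ ξ, ‖b + ((p.gradOracle y ξ - gradient p.f y)
        - (1 - α) • (p.gradOracle x ξ - gradient p.f x))‖ₑ ^ 2 ∂p.P
      ≤ ENNReal.ofReal (‖b‖ ^ 2 + 2 * κ.Lgf ^ 2 * ‖y - x‖ ^ 2 + 2 * α ^ 2 * κ.σf ^ 2) := by
  have := h.prob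
  have hZ : MemLp (fun ξ => (p.gradOracle y ξ - gradient p.f y)
      - (1 - α) • (p.gradOracle x ξ - gradient p.f x)) 2 p.P :=
    (h.memLp_noise hy).sub ((h.memLp_noise hx).const_smul (1 - α))
  have hbZ : MemLp (fun ξ => b + ((p.gradOracle y ξ - gradient p.f y)
      - (1 - α) • (p.gradOracle x ξ - gradient p.f x))) 2 p.P := (memLp_const b).add hZ
  rw [lintegral_enorm_sq_eq hbZ]
  refine ENNReal.ofReal_le_ofReal ?_
  -- The fresh noise has mean zero, so the cross term with `b` vanishes and only its second moment
  -- remains.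
  have h0 : ∫ ξ, ((p.gradOracle y ξ - gradient p.f y)
      - (1 - α) • (p.gradOracle x ξ - gradient p.f x)) ∂p.P = 0 := by
    have hi : Integrable (fun ξ => (1 - α) • (p.gradOracle x ξ - gradient p.f x)) p.P :=
      ((h.memLp_noise hx).integrable (by norm_num)).smul (1 - α)
    rw [integral_sub ((h.memLp_noise hy).integrable (by norm_num)) hi, integral_smul,
      h.integral_noise hx, h.integral_noise hy]
    simp
  have h1 := integral_norm_add_sq hZ b
  rw [h0, inner_zero_right, mul_zero, add_zero] at h1
  have hD := h.memLp_oracle_sub hy hx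
  have hY := integral_norm_sub_integral_sq_le hD
  rw [h.integral_oracle_sub hy hx] at hY
  have hY' := hY.trans (h.integral_oracle_sub_sq_le hy hx)
  have hYm : MemLp (fun ξ => p.gradOracle y ξ - p.gradOracle x ξ
      - (gradient p.f y - gradient p.f x)) 2 p.P := hD.sub (memLp_const _)
  have h2 : ∫ ξ, ‖(p.gradOracle y ξ - gradient p.f y)
      - (1 - α) • (p.gradOracle x ξ - gradient p.f x)‖ ^ 2 ∂p.P
      ≤ ∫ ξ, (2 * ‖p.gradOracle y ξ - p.gradOracle x ξ - (gradient p.f y - gradient p.f x)‖ ^ 2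
        + 2 * α ^ 2 * ‖p.gradOracle y ξ - gradient p.f y‖ ^ 2) ∂p.P := by
    refine integral_mono (integrable_norm_sq hZ) (((integrable_norm_sq hYm).const_mul 2).add
      ((integrable_norm_sq (h.memLp_noise hy)).const_mul _)) fun ξ => ?_
    set u := p.gradOracle y ξ - p.gradOracle x ξ - (gradient p.f y - gradient p.f x)
    set v := p.gradOracle y ξ - gradient p.f y
    -- The new noise splits into a part controlled by the movement `y - x` and a part of size `α`:
    -- this is the variance reduction.
    have he : v - (1 - α) • (p.gradOracle x ξ - gradient p.f x) = (1 - α) • u + α • v := by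
      simp only [u, v]; module
    have hn : ‖(1 - α) • u + α • v‖ ≤ ‖u‖ + α * ‖v‖ := by
      refine (norm_add_le _ _).trans ?_
      rw [norm_smul, norm_smul, Real.norm_eq_abs, Real.norm_eq_abs, abs_of_nonneg hα0,
        abs_of_nonneg (by linarith)]
      nlinarith [norm_nonneg u]
    simp only [he]
    have := pow_le_pow_left₀ (norm_nonneg _) hn 2
    nlinarith [sq_nonneg (‖u‖ - α * ‖v‖)]
  rw [integral_add ((integrable_norm_sq hYm).const_mul 2)
    ((integrable_norm_sq (h.memLp_noise hy)).const_mul _), integral_const_mul,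
    integral_const_mul] at h2
  have h3 := mul_le_mul_of_nonneg_left (h.integral_noise_sq_le hy)
    (by positivity : 0 ≤ 2 * α ^ 2)
  refine h1.trans_le ?_
  linarith

theorem norm_jacT_sub_le (h : p.Assumptions κ) {x y : Vec d} (hx : x ∈ p.X) (hy : y ∈ p.X) :
    ‖p.jacT x (p.c x) - p.jacT y (p.c y)‖
      ≤ m * (κ.Cc * κ.Lgc + κ.Cgc * κ.Lc) * ‖x - y‖ := by
  have he : p.jacT x (p.c x) - p.jacT y (p.c y)
      = ∑ i, (p.c x i • (p.gradC i x - p.gradC i y) + (p.c x i - p.c y i) • p.gradC i y) := by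
    rw [jacT, jacT, ← Finset.sum_sub_distrib]
    refine Finset.sum_congr rfl fun i _ => ?_
    module
  rw [he]
  refine (norm_sum_le_of_le (f := _) (n := fun _ => (κ.Cc * κ.Lgc + κ.Cgc * κ.Lc) * ‖x - y‖) _
    fun i _ => ?_).trans (le_of_eq ?_)
  · refine (norm_add_le _ _).trans ?_
    rw [norm_smul, norm_smul, Real.norm_eq_abs, Real.norm_eq_abs]
    have h1 := mul_le_mul (h.bound_c x hx i) (h.smooth_c x hx y hy i) (norm_nonneg _) κ.Cc_nonneg
    have h2 := mul_le_mul (h.lipschitz_c x hx y hy i) (h.bound_gradC y hy i) (norm_nonneg _)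
      (mul_nonneg κ.Lc_nonneg (norm_nonneg _))
    linarith
  · simp; ring

theorem norm_gradQ_sub_le (h : p.Assumptions κ) {x y : Vec d} (hx : x ∈ p.X) (hy : y ∈ p.X)
    {r : ℝ} (hr : 1 ≤ r) :
    ‖p.gradQ r x - p.gradQ r y‖ ≤ κ.Ltilde m * r * ‖x - y‖ := by
  have he : p.gradQ r x - p.gradQ r y = (gradient p.f x - gradient p.f y)
      + r • (p.jacT x (p.c x) - p.jacT y (p.c y)) := by
    simp only [gradQ]; module
  -- `(a + b + c)² ≤ 4(a² + b² + c²)`, with the three summands of the definition of `L̃²`.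
  have hL : κ.Lgf + m * (κ.Cc * κ.Lgc + κ.Cgc * κ.Lc) ≤ κ.Ltilde m := by
    refine Real.le_sqrt_of_sq_le ?_
    nlinarith [sq_nonneg (κ.Lgf - m * (κ.Cc * κ.Lgc)), sq_nonneg (κ.Lgf - m * (κ.Cgc * κ.Lc)),
      sq_nonneg (m * (κ.Cc * κ.Lgc) - m * (κ.Cgc * κ.Lc)), sq_nonneg κ.Lgf,
      sq_nonneg (m * (κ.Cc * κ.Lgc)), sq_nonneg (m * (κ.Cgc * κ.Lc))]
  have h1 := h.norm_gradf_sub_le hx hy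
  have h2 := h.norm_jacT_sub_le hx hy
  have h3 := κ.Lgf_nonneg
  have h4 := norm_nonneg (x - y)
  rw [he]
  calc _ ≤ ‖gradient p.f x - gradient p.f y‖ + r * ‖p.jacT x (p.c x) - p.jacT y (p.c y)‖ := by
        refine (norm_add_le _ _).trans (le_of_eq ?_)
        rw [norm_smul, Real.norm_eq_abs, abs_of_pos (by linarith)]
    _ ≤ κ.Lgf * ‖x - y‖ + r * (m * (κ.Cc * κ.Lgc + κ.Cgc * κ.Lc) * ‖x - y‖) := by gcongr
    _ ≤ r * (κ.Lgf * ‖x - y‖) + r * (m * (κ.Cc * κ.Lgc + κ.Cgc * κ.Lc) * ‖x - y‖) := by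
        exact add_le_add_left (le_mul_of_one_le_left (by positivity) hr) _
    _ = (κ.Lgf + m * (κ.Cc * κ.Lgc + κ.Cgc * κ.Lc)) * r * ‖x - y‖ := by ring
    _ ≤ _ := by gcongr

theorem differentiable_c_apply (h : p.Assumptions κ) (i : Fin m) :
    Differentiable ℝ fun y => p.c y i :=
  (EuclideanSpace.proj (𝕜 := ℝ) i).differentiable.comp h.diff_c

theorem hasFDerivAt_Q (h : p.Assumptions κ) (r : ℝ) (x : Vec d) :
    HasFDerivAt (p.Q r) (InnerProductSpace.toDual ℝ (Vec d) (p.gradQ r x)) x := by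
  have hf := ((h.diff_f x).hasGradientAt).hasFDerivAt
  have hc := fun i => ((h.differentiable_c_apply i x).hasGradientAt).hasFDerivAt
  have hs := HasFDerivAt.fun_sum (u := Finset.univ) fun i _ => (hc i).pow 2
  refine (hf.add (hs.const_mul (r / 2))).congr_fderiv ?_
  ext v
  simp only [gradQ, jacT, gradC, Finset.smul_sum, map_add, map_sum, map_smul, add_apply,
    smul_apply, sum_apply, InnerProductSpace.toDual_apply_apply, smul_eq_mul,
    Nat.cast_ofNat, Nat.add_one_sub_one, pow_one, nsmul_eq_mul]
  congr 1
  refine Finset.sum_congr rfl fun i _ => ?_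
  ring

/-- The descent lemma for the penalty function. -/
theorem Q_le_add (h : p.Assumptions κ) {x y : Vec d} (hx : x ∈ p.X) (hy : y ∈ p.X)
    {r : ℝ} (hr : 1 ≤ r) (hL : 0 ≤ κ.Ltilde m) :
    p.Q r y ≤ p.Q r x + inner ℝ (p.gradQ r x) (y - x) + κ.Ltilde m * r * ‖y - x‖ ^ 2 := by
  -- The mean value theorem replaces the integral form of the remainder; this costs the factor `1/2`
  -- in the quadratic term.
  obtain ⟨z, hz, hzq⟩ := domain_mvt (fun z _ => (h.hasFDerivAt_Q r z).hasFDerivWithinAt)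
    h.convex hx hy
  have hzX := h.convex.segment_subset hx hy hz
  rw [InnerProductSpace.toDual_apply_apply] at hzq
  have h1 := h.norm_gradQ_sub_le hzX hx hr
  have h2 : ‖z - x‖ ≤ ‖y - x‖ := by
    obtain ⟨t, ⟨ht0, ht1⟩, rfl⟩ := (segment_eq_image' ℝ x y ▸ hz)
    simp only [add_sub_cancel_left, norm_smul, Real.norm_eq_abs, abs_of_nonneg ht0]
    exact mul_le_of_le_one_left (norm_nonneg _) ht1
  have h3 := real_inner_le_norm (p.gradQ r z - p.gradQ r x) (y - x)
  rw [inner_sub_left] at h3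
  have h4 : ‖p.gradQ r z - p.gradQ r x‖ * ‖y - x‖ ≤ κ.Ltilde m * r * ‖y - x‖ * ‖y - x‖ := by
    gcongr
    refine h1.trans ?_
    gcongr
  nlinarith

theorem norm_c_sq_le (h : p.Assumptions κ) {x : Vec d} (hx : x ∈ p.X) :
    ‖p.c x‖ ^ 2 ≤ m * κ.Cc ^ 2 := by
  rw [EuclideanSpace.norm_sq_eq]
  refine (Finset.sum_le_card_nsmul _ _ (κ.Cc ^ 2) fun i _ => ?_).trans (le_of_eq ?_)
  · exact pow_le_pow_left₀ (norm_nonneg _) (h.bound_c x hx i) 2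
  · simp

end Assumptions

end Problem

/-! ### The stationarity gap and the decrease along one projected step. -/

namespace Problem

variable {d m : ℕ} {Ξ : Type*} [MeasurableSpace Ξ] {p : Problem d m Ξ} {κ : Constants}

/-- The distance of `∇Q_r(x)` to `-N_X(x)`. -/
noncomputable def statGap (p : Problem d m Ξ) (r : ℝ) (x : Vec d) : ℝ :=
  Metric.infDist (p.gradQ r x) (-normalCone p.X x)

theorem statGap_nonneg (r : ℝ) (x : Vec d) : 0 ≤ p.statGap r x := Metric.infDist_nonneg

namespace Assumptions

/-- The optimality condition of the projection exhibits `η⁻¹(y - x) + g` as an element of `-N_X(y)`;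
the bound is the distance from `∇Q_r(y)` to this element. -/
theorem statGap_proj_le (h : p.Assumptions κ) {x g : Vec d} (hx : x ∈ p.X) {η r : ℝ} (hη : 0 < η)
    (hr : 1 ≤ r) (hLr : κ.Ltilde m * r ≤ 1 / (9 * η)) :
    p.statGap r (proj p.X (x - η • g))
      ≤ 10 / 9 * (‖proj p.X (x - η • g) - x‖ / η) + ‖g - p.gradQ r x‖ := by
  have hne : p.X.Nonempty := ⟨x, hx⟩
  have hN := sub_proj_mem_normalCone hne h.closed h.convex (x - η • g)
  have hm := proj_mem hne h.closed (x - η • g)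
  set y := proj p.X (x - η • g)
  have hmem : η⁻¹ • (y - x + η • g) ∈ -normalCone p.X y := by
    refine smul_mem_neg_normalCone (inv_nonneg.2 hη.le) ?_
    have : -(y - x + η • g) = x - η • g - y := by abel
    rw [Set.mem_neg, this]; exact hN
  have he : p.gradQ r y - η⁻¹ • (y - x + η • g)
      = (p.gradQ r y - p.gradQ r x) - η⁻¹ • (y - x) - (g - p.gradQ r x) := by
    rw [smul_add, smul_smul, inv_mul_cancel₀ hη.ne']; module
  have h1 := h.norm_gradQ_sub_le hm hx hr
  have h2 : κ.Ltilde m * r * ‖y - x‖ ≤ 1 / (9 * η) * ‖y - x‖ := by gcongr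
  calc p.statGap r y ≤ dist (p.gradQ r y) (η⁻¹ • (y - x + η • g)) :=
        Metric.infDist_le_dist_of_mem hmem
    _ ≤ ‖p.gradQ r y - p.gradQ r x‖ + ‖η⁻¹ • (y - x)‖ + ‖g - p.gradQ r x‖ := by
        rw [dist_eq_norm, he]
        exact (norm_sub_le _ _).trans (add_le_add_left (norm_sub_le _ _) _)
    _ ≤ 1 / (9 * η) * ‖y - x‖ + η⁻¹ * ‖y - x‖ + ‖g - p.gradQ r x‖ := by
        rw [norm_smul, Real.norm_eq_abs, abs_of_pos (inv_pos.2 hη)]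
        gcongr
        exact h1.trans h2
    _ = _ := by field_simp; ring

/-- The decrease of the penalty function along one projected step. -/
theorem Q_proj_add_le (h : p.Assumptions κ) {x g : Vec d} (hx : x ∈ p.X) {η r : ℝ} (hη : 0 < η)
    (hr : 1 ≤ r) (hL : 0 ≤ κ.Ltilde m) (hLr : κ.Ltilde m * r ≤ 1 / (9 * η)) :
    p.Q r (proj p.X (x - η • g)) + η / 8 * p.statGap r (proj p.X (x - η • g)) ^ 2
        + 1 / (144 * η) * ‖proj p.X (x - η • g) - x‖ ^ 2
      ≤ p.Q r x + η * ‖g - p.gradQ r x‖ ^ 2 := by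
  have hne : p.X.Nonempty := ⟨x, hx⟩
  have hs := h.statGap_proj_le (g := g) hx hη hr hLr
  have hN := sub_proj_mem_normalCone hne h.closed h.convex (x - η • g) x hx
  have hm := proj_mem hne h.closed (x - η • g)
  set y := proj p.X (x - η • g)
  have h0 := p.statGap_nonneg r y
  have hd := h.Q_le_add hx hm hr hL
  set e := g - p.gradQ r x
  have h1 : inner ℝ (p.gradQ r x) (y - x) = inner ℝ g (y - x) - inner ℝ e (y - x) := by
    rw [← inner_sub_left]; simp [e]
  have h2 : η * inner ℝ g (y - x) ≤ -‖y - x‖ ^ 2 := by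
    have : inner ℝ (x - η • g - y) (x - y) = ‖y - x‖ ^ 2 + η * inner ℝ g (y - x) := by
      have e1 : x - η • g - y = -((y - x) + η • g) := by abel
      have e2 : x - y = -(y - x) := by abel
      rw [e1, e2, inner_neg_neg, inner_add_left, real_inner_self_eq_norm_sq,
        real_inner_smul_left]
    linarith
  have h3 := abs_le.1 (abs_real_inner_le_norm e (y - x))
  have h4 : κ.Ltilde m * r * ‖y - x‖ ^ 2 ≤ 1 / (9 * η) * ‖y - x‖ ^ 2 := by gcongr
  set D := ‖y - x‖
  set E := ‖e‖
  set S := p.statGap r y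
  -- In terms of `w = D / η` every term is a multiple of `η w²` or `η E²`. The descent leaves `-(1 -
  -- 1/2 - 1/9) η w²`, which covers the required `(5/16 + 1/144) η w²`, and the coefficients of `η
  -- E²` add up to `3/4`.
  obtain ⟨w, hw⟩ : ∃ w, w = D / η := ⟨_, rfl⟩
  have hDw : D = η * w := by rw [hw]; field_simp
  have h2' : inner ℝ g (y - x) ≤ -(η * w ^ 2) := by
    have : η * inner ℝ g (y - x) ≤ η * (-(η * w ^ 2)) := by rw [hDw] at h2; linarith
    exact le_of_mul_le_mul_left this hη
  have h4' : κ.Ltilde m * r * D ^ 2 ≤ 1 / 9 * (η * w ^ 2) := by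
    refine h4.trans (le_of_eq ?_)
    rw [hDw]; field_simp
  have h5 : 1 / (144 * η) * D ^ 2 = 1 / 144 * (η * w ^ 2) := by rw [hDw]; field_simp
  rw [← hw] at hs
  have h6 : S ^ 2 ≤ 5 / 2 * w ^ 2 + 2 * E ^ 2 := by
    have := pow_le_pow_left₀ h0 hs 2
    nlinarith [sq_nonneg (10 / 9 * w - E), sq_nonneg w]
  have h6' := mul_le_mul_of_nonneg_left h6 hη.le
  have h7 : E * D ≤ 1 / 2 * (η * w ^ 2) + 1 / 2 * (η * E ^ 2) := by
    rw [hDw]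
    nlinarith [mul_nonneg hη.le (sq_nonneg (w - E))]
  have h8 : 0 ≤ η * w ^ 2 := by positivity
  have h9 : 0 ≤ η * E ^ 2 := by positivity
  rw [h5]
  linarith [h3.1]

/-- Scaling the regularity condition by `r` is possible since the normal cone is a cone; adding
`∇f(x)` then moves the distance by at most `C_{∇f}`. This is what turns stationarity into
feasibility. -/
theorem mul_norm_c_le (h : p.Assumptions κ) {x : Vec d} (hx : x ∈ p.X) {r : ℝ} (hr : 0 < r)
    (hreg : κ.δ * ‖p.c x‖ ≤ Metric.infDist (p.jacT x (p.c x)) (-normalCone p.X x)) :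
    κ.δ * r * ‖p.c x‖ ≤ p.statGap r x + κ.Cgf := by
  have h1 := mul_infDist_neg_normalCone_le (X := p.X) hr x (p.jacT x (p.c x))
  have h2 := Metric.infDist_le_infDist_add_dist (s := -normalCone p.X x)
    (x := r • p.jacT x (p.c x)) (y := p.gradQ r x)
  have h3 : dist (r • p.jacT x (p.c x)) (p.gradQ r x) ≤ κ.Cgf := by
    rw [dist_eq_norm, gradQ, sub_add_cancel_right, norm_neg]
    exact h.bound_gradf x hx
  have h4 := mul_le_mul_of_nonneg_left hreg hr.le
  rw [statGap]
  linarith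

end Assumptions

end Problem

/-! ### The step size, penalty and momentum schedules. -/

section Parameters

theorem rpow_quarter_pow_four (k : ℕ) : ((k : ℝ) ^ (1 / 4 : ℝ)) ^ 4 = k := by
  rw [← Real.rpow_natCast, ← Real.rpow_mul (Nat.cast_nonneg k)]; norm_num

theorem rpow_half_eq_sq (k : ℕ) : (k : ℝ) ^ (1 / 2 : ℝ) = ((k : ℝ) ^ (1 / 4 : ℝ)) ^ 2 := by
  rw [← Real.rpow_natCast, ← Real.rpow_mul (Nat.cast_nonneg k)]; norm_num

theorem one_le_rpow_quarter {k : ℕ} (hk : 1 ≤ k) : 1 ≤ (k : ℝ) ^ (1 / 4 : ℝ) :=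
  Real.one_le_rpow (by exact_mod_cast hk) (by norm_num)

theorem rpow_quarter_le_succ (k : ℕ) : (k : ℝ) ^ (1 / 4 : ℝ) ≤ ((k + 1 : ℕ) : ℝ) ^ (1 / 4 : ℝ) :=
  Real.rpow_le_rpow (Nat.cast_nonneg k) (by push_cast; linarith) (by norm_num)

theorem stepSize_eq (L ρ : ℝ) (k : ℕ) :
    stepSize L ρ k = 1 / (9 * L * ρ * (((k + 1 : ℕ) : ℝ) ^ (1 / 4 : ℝ)) ^ 2) := by
  rw [stepSize, ← rpow_half_eq_sq]; push_cast; rfl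

theorem stepSize_pos {L ρ : ℝ} (hL : 0 < L) (hρ : 1 < ρ) (k : ℕ) : 0 < stepSize L ρ k := by
  rw [stepSize]; positivity

theorem one_le_penalty {ρ : ℝ} (hρ : 1 < ρ) {k : ℕ} (hk : 1 ≤ k) : 1 ≤ penalty ρ k := by
  have := one_le_rpow_quarter hk
  rw [penalty]; nlinarith

/-- This proportionality makes the weight `1 / (8 L̃ ρ)` in the potential convert the contraction of
the error into exactly `η_k ‖e_k‖²`. -/
theorem momentum_succ_eq {L ρ : ℝ} (hL : 0 < L) (hρ : 1 < ρ) (k : ℕ) :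
    momentum (k + 1) = 8 * L * ρ * stepSize L ρ k := by
  have : (0 : ℝ) < ((k : ℝ) + 1) ^ (1 / 2 : ℝ) := by positivity
  rw [momentum, stepSize]; push_cast; field_simp; norm_num

theorem momentum_nonneg (k : ℕ) : 0 ≤ momentum k := by
  rw [momentum]; positivity

theorem momentum_sq (k : ℕ) : momentum k ^ 2 = 64 / 81 / k := by
  rcases Nat.eq_zero_or_pos k with rfl | hk
  · simp [momentum]
  have h : ((k : ℝ) ^ (1 / 2 : ℝ)) ^ 2 = k := by
    rw [rpow_half_eq_sq, ← pow_mul, rpow_quarter_pow_four]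
  rw [momentum, div_pow, mul_pow, h]; field_simp; norm_num

theorem momentum_le_one {k : ℕ} (hk : 1 ≤ k) : momentum k ≤ 1 := by
  have h1 : (1 : ℝ) ≤ k := by exact_mod_cast hk
  have h2 : momentum k ^ 2 ≤ 1 := by
    rw [momentum_sq, div_div, div_le_one (by positivity)]; linarith
  nlinarith [momentum_nonneg k]

theorem mul_penalty_le {L ρ : ℝ} (hL : 0 < L) (hρ : 1 < ρ) {k : ℕ} (hk : 1 ≤ k) :
    L * penalty ρ k ≤ 1 / (9 * stepSize L ρ k) := by
  have h1 := one_le_rpow_quarter hk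
  have h2 := rpow_quarter_le_succ k
  rw [penalty, stepSize_eq]
  set t := (k : ℝ) ^ (1 / 4 : ℝ)
  set s := ((k + 1 : ℕ) : ℝ) ^ (1 / 4 : ℝ)
  have hs : 0 < s := by linarith
  have h3 : 1 / (9 * (1 / (9 * L * ρ * s ^ 2))) = L * ρ * s ^ 2 := by field_simp
  rw [h3, mul_assoc]
  gcongr L * (ρ * ?_)
  nlinarith

/-- The growth of the penalty parameter costs a fraction of the stationarity gap and a term of
order `1 / k`. -/
theorem penalty_growth_le {L ρ δ S G u U : ℝ} (hL : 0 < L) (hρ : 1 < ρ) (hδ : 0 < δ)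
    (hu : 0 ≤ u) (huU : u ^ 2 ≤ U) {k : ℕ} (hk : 1 ≤ k)
    (hreg : δ * penalty ρ k * u ≤ S + G) :
    (penalty ρ (k + 1) - penalty ρ k) / 2 * u ^ 2
      ≤ stepSize L ρ k / 16 * S ^ 2 + (G ^ 2 / (δ ^ 2 * ρ) + ρ * U * (288 * L / δ ^ 2)) / k := by
  have h1 := one_le_rpow_quarter hk
  have h2 := rpow_quarter_le_succ k
  have h3 := rpow_quarter_pow_four k
  have h4 := rpow_quarter_pow_four (k + 1)
  rw [stepSize_eq]
  rw [penalty] at hreg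
  rw [penalty, penalty]
  set t := (k : ℝ) ^ (1 / 4 : ℝ)
  set s := ((k + 1 : ℕ) : ℝ) ^ (1 / 4 : ℝ)
  have hs : 0 < s := by linarith
  have ht : 0 < t := by linarith
  have hst : s ^ 4 = t ^ 4 + 1 := by rw [h4, h3]; push_cast; rfl
  -- From `(s - t)(s³ + s²t + st² + t³) = s⁴ - t⁴ = 1`.
  have hdiff : (s - t) ≤ 1 / t ^ 3 := by
    rw [le_div_iff₀ (by positivity)]
    nlinarith [pow_pos ht 3, pow_pos hs 3, mul_nonneg (sub_nonneg.2 h2)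
      (by positivity : 0 ≤ s ^ 3 + s ^ 2 * t + s * t ^ 2)]
  have hs2 : s ^ 2 ≤ 2 * t ^ 2 := by
    have : 1 ≤ t ^ 4 := one_le_pow₀ h1
    refine le_of_sq_le_sq ?_ (by positivity)
    nlinarith
  have hU : 0 ≤ U := (sq_nonneg u).trans huU
  rw [← h3]
  have hlhs : (ρ * s - ρ * t) / 2 * u ^ 2 ≤ ρ / (2 * t ^ 3) * u ^ 2 := by
    calc (ρ * s - ρ * t) / 2 * u ^ 2 = ρ / 2 * (s - t) * u ^ 2 := by ring
      _ ≤ ρ / 2 * (1 / t ^ 3) * u ^ 2 := by gcongr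
      _ = _ := by field_simp
  refine hlhs.trans ?_
  -- For large `k` regularity bounds `u²`, and the coefficient of `S²`, of order `t⁻⁵`, is below
  -- `η_k / 16`, of order `s⁻²`. For the remaining small `k`, the a priori bound `U` suffices,
  -- because `t` is then bounded by a constant.
  by_cases hc : 288 * L ≤ δ ^ 2 * t ^ 3
  · have hu2 : u ^ 2 ≤ 2 * (S ^ 2 + G ^ 2) / (δ ^ 2 * ρ ^ 2 * t ^ 2) := by
      rw [le_div_iff₀ (by positivity)]
      have := pow_le_pow_left₀ (by positivity) hreg 2
      nlinarith [sq_nonneg (S - G)]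
    calc ρ / (2 * t ^ 3) * u ^ 2
        ≤ ρ / (2 * t ^ 3) * (2 * (S ^ 2 + G ^ 2) / (δ ^ 2 * ρ ^ 2 * t ^ 2)) := by gcongr
      _ = 1 / (δ ^ 2 * ρ * t ^ 5) * S ^ 2 + G ^ 2 / (δ ^ 2 * ρ) / t ^ 5 := by field_simp
      _ ≤ 1 / (9 * L * ρ * s ^ 2) / 16 * S ^ 2
          + (G ^ 2 / (δ ^ 2 * ρ) + ρ * U * (288 * L / δ ^ 2)) / t ^ 4 := by
        gcongr ?_ * S ^ 2 + ?_
        · rw [div_div]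
          refine one_div_le_one_div_of_le (by positivity) ?_
          calc 9 * L * ρ * s ^ 2 * 16 ≤ 9 * L * ρ * (2 * t ^ 2) * 16 := by gcongr
            _ = ρ * t ^ 2 * (288 * L) := by ring
            _ ≤ ρ * t ^ 2 * (δ ^ 2 * t ^ 3) := by gcongr
            _ = _ := by ring
        · gcongr
          · have : 0 ≤ ρ * U * (288 * L / δ ^ 2) := by positivity
            linarith
          · norm_num
  · have hB : t ^ 3 ≤ 288 * L / δ ^ 2 := by
      rw [le_div_iff₀ (by positivity)]; linarith
    -- Bounding `t` itself trades the factor `1/t³` for `1/t⁴ = 1/k`.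
    have htB : t ≤ 288 * L / δ ^ 2 := (le_self_pow₀ h1 (by norm_num)).trans hB
    set B := 288 * L / δ ^ 2
    calc ρ / (2 * t ^ 3) * u ^ 2 ≤ ρ / (2 * t ^ 3) * U := by gcongr
      _ = ρ * U * (t / 2) / t ^ 4 := by field_simp
      _ ≤ ρ * U * B / t ^ 4 := by gcongr; linarith
      _ ≤ (G ^ 2 / (δ ^ 2 * ρ) + ρ * U * B) / t ^ 4 := by
        gcongr
        have : 0 ≤ G ^ 2 / (δ ^ 2 * ρ) := by positivity
        linarith
      _ ≤ _ := by
        have : 0 ≤ 1 / (9 * L * ρ * s ^ 2) / 16 * S ^ 2 := by positivity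
        linarith

end Parameters

/-! ### Measurability of the method and independence from the next sample. -/

/-- Integrating out a variable that is independent of the past. -/
theorem lintegral_le_of_indepFun {Ω α Ξ : Type*} [MeasurableSpace Ω] [MeasurableSpace α]
    [MeasurableSpace Ξ] {μ : Measure Ω} [IsProbabilityMeasure μ] {P : Measure Ξ} {S : Ω → α}
    {ζ : Ω → Ξ} (hS : Measurable S) (hζ : Measurable ζ) (hP : μ.map ζ = P)
    (hind : IndepFun S ζ μ) {F : α × Ξ → ENNReal} (hF : Measurable F) {B : Ω → ENNReal}
    (hB : ∀ ω, ∫⁻ ξ, F (S ω, ξ) ∂P ≤ B ω) :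
    ∫⁻ ω, F (S ω, ζ ω) ∂μ ≤ ∫⁻ ω, B ω ∂μ := by
  subst hP
  have : IsProbabilityMeasure (μ.map ζ) := Measure.isProbabilityMeasure_map hζ.aemeasurable
  have : IsProbabilityMeasure (μ.map S) := Measure.isProbabilityMeasure_map hS.aemeasurable
  have h1 := (indepFun_iff_map_prod_eq_prod_map_map hS.aemeasurable hζ.aemeasurable).1 hind
  rw [← lintegral_map hF (hS.prodMk hζ), h1, lintegral_prod _ hF.aemeasurable,
    lintegral_map hF.lintegral_prod_right' hS]
  exact lintegral_mono hB

theorem measurable_gradient {d : ℕ} (f : Vec d → ℝ) : Measurable (gradient f) :=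
  (InnerProductSpace.toDual ℝ (Vec d)).symm.continuous.measurable.comp (measurable_fderiv ℝ f)

namespace Problem

variable {d m : ℕ} {Ξ : Type*} [MeasurableSpace Ξ] {p : Problem d m Ξ} {κ : Constants}

theorem run_succ_fst (η r α : ℕ → ℝ) (x₁ : Vec d) (ζ : ℕ → Ξ) (k : ℕ) :
    (p.run η r α x₁ ζ (k + 2)).1 = proj p.X ((p.run η r α x₁ ζ (k + 1)).1
      - η (k + 1) • (p.run η r α x₁ ζ (k + 1)).2) := by
  rw [run]

theorem run_succ_snd (η r α : ℕ → ℝ) (x₁ : Vec d) (ζ : ℕ → Ξ) (k : ℕ) :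
    (p.run η r α x₁ ζ (k + 2)).2
      = p.oracleQ (r (k + 2)) (p.run η r α x₁ ζ (k + 2)).1 (ζ (k + 2))
      + (1 - α (k + 2)) • ((p.run η r α x₁ ζ (k + 1)).2
        - p.oracleQ (r (k + 1)) (p.run η r α x₁ ζ (k + 1)).1 (ζ (k + 2))) := by
  rw [run]

namespace Assumptions

theorem run_mem (h : p.Assumptions κ) (η r α : ℕ → ℝ) {x₁ : Vec d} (hx₁ : x₁ ∈ p.X) (ζ : ℕ → Ξ) :
    ∀ k, (p.run η r α x₁ ζ k).1 ∈ p.X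
  | 0 => by rw [run]; exact hx₁
  | 1 => by rw [run]; exact hx₁
  | k + 2 => by rw [run_succ_fst]; exact proj_mem ⟨x₁, hx₁⟩ h.closed _

theorem measurable_c (h : p.Assumptions κ) : Measurable p.c := h.diff_c.continuous.measurable

theorem measurable_jacT (h : p.Assumptions κ) : Measurable fun x => p.jacT x (p.c x) := by
  refine Finset.measurable_sum _ fun i _ => ?_
  exact (h.differentiable_c_apply i).continuous.measurable.smul (measurable_gradient _)

theorem measurable_gradQ (h : p.Assumptions κ) (r : ℝ) : Measurable (p.gradQ r) :=
  (measurable_gradient _).add (h.measurable_jacT.const_smul r)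

theorem measurable_oracleQ (h : p.Assumptions κ) (r : ℝ) :
    Measurable fun z : Vec d × Ξ => p.oracleQ r z.1 z.2 :=
  h.measurable_oracle.add ((h.measurable_jacT.const_smul r).comp measurable_fst)

theorem measurable_Q (h : p.Assumptions κ) (r : ℝ) : Measurable (p.Q r) :=
  h.diff_f.continuous.measurable.add ((Finset.measurable_sum _ fun i _ =>
    (h.differentiable_c_apply i).continuous.measurable.pow_const 2).const_mul _)

theorem abs_Q_le (h : p.Assumptions κ) {r : ℝ} (hr : 0 ≤ r) {x : Vec d} (hx : x ∈ p.X)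
    (hf : |p.f x| ≤ κ.Bf) : |p.Q r x| ≤ κ.Bf + r / 2 * (m * κ.Cc ^ 2) := by
  have h1 := h.norm_c_sq_le hx
  rw [EuclideanSpace.real_norm_sq_eq] at h1
  have h2 : 0 ≤ ∑ i, p.c x i ^ 2 := Finset.sum_nonneg fun i _ => sq_nonneg _
  rw [Q]
  refine (abs_add_le _ _).trans (add_le_add hf ?_)
  rw [abs_of_nonneg (by positivity)]
  gcongr

/-- The state of the method after `k + 1` steps is a measurable function of the first `k + 1`
samples. -/
theorem exists_measurable_run (h : p.Assumptions κ) (η r α : ℕ → ℝ) {x₁ : Vec d}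
    (hx₁ : x₁ ∈ p.X) (k : ℕ) :
    ∃ H : (Finset.range (k + 1) → Ξ) → Vec d × Vec d, Measurable H ∧
      ∀ ζ : ℕ → Ξ, p.run η r α x₁ ζ (k + 1) = H fun i => ζ (i + 1) := by
  induction k with
  | zero =>
    refine ⟨fun z => (x₁, p.oracleQ (r 1) x₁ (z ⟨0, by simp⟩)), ?_, fun ζ => by rw [run]⟩
    exact measurable_const.prodMk
      ((h.measurable_oracleQ (r 1)).comp (measurable_const.prodMk (measurable_pi_apply _)))
  | succ k ih =>
    obtain ⟨H, hH, hrun⟩ := ih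
    let R : (Finset.range (k + 2) → Ξ) → (Finset.range (k + 1) → Ξ) := fun z i =>
      z ⟨i, by have := Finset.mem_range.1 i.2; simp; omega⟩
    have hR : Measurable R := measurable_pi_lambda _ fun i => measurable_pi_apply _
    let ℓ : (Finset.range (k + 2) → Ξ) → Ξ := fun z => z ⟨k + 1, by simp⟩
    have hℓ : Measurable ℓ := measurable_pi_apply _
    have hHR : Measurable fun z => H (R z) := hH.comp hR
    let x' : (Finset.range (k + 2) → Ξ) → Vec d := fun z =>
      proj p.X ((H (R z)).1 - η (k + 1) • (H (R z)).2)
    have hx' : Measurable x' := (continuous_proj ⟨x₁, hx₁⟩ h.closed h.convex).measurable.comp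
      (hHR.fst.sub (hHR.snd.const_smul (η (k + 1))))
    refine ⟨fun z => (x' z, p.oracleQ (r (k + 2)) (x' z) (ℓ z)
      + (1 - α (k + 2)) • ((H (R z)).2 - p.oracleQ (r (k + 1)) (H (R z)).1 (ℓ z))), ?_,
      fun ζ => ?_⟩
    · have h1 := (h.measurable_oracleQ (r (k + 2))).comp (hx'.prodMk hℓ)
      have h2 := (h.measurable_oracleQ (r (k + 1))).comp (hHR.fst.prodMk hℓ)
      exact hx'.prodMk (h1.add ((hHR.snd.sub h2).const_smul (1 - α (k + 2))))
    · have := hrun ζ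
      rw [run]
      simp only [this]
      rfl

end Assumptions

/-- `ξ 1, ξ 2, …` are i.i.d. samples with law `P`. -/
structure IsSample (p : Problem d m Ξ) {Ω : Type*} [MeasurableSpace Ω] (μ : Measure Ω)
    (ξ : ℕ → Ω → Ξ) : Prop where
  measurable : ∀ k, 1 ≤ k → Measurable (ξ k)
  law : ∀ k, 1 ≤ k → μ.map (ξ k) = p.P
  indep : iIndepFun (fun k => ξ (k + 1)) μ

/-- The gradient estimate `g_k`. -/
noncomputable def estimate (p : Problem d m Ξ) (κ : Constants) (ρ : ℝ) (x₁ : Vec d) (ζ : ℕ → Ξ)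
    (k : ℕ) : Vec d :=
  (p.run (stepSize (κ.Ltilde m) ρ) (penalty ρ) momentum x₁ ζ k).2

/-- The error `g_k - ∇Q_{ρ_k}(x_k)` of the gradient estimate. -/
noncomputable def gradErr (p : Problem d m Ξ) (κ : Constants) (ρ : ℝ) (x₁ : Vec d) (ζ : ℕ → Ξ)
    (k : ℕ) : Vec d :=
  p.estimate κ ρ x₁ ζ k - p.gradQ (penalty ρ k) (iterate p κ ρ x₁ ζ k)

theorem iterate_succ (κ : Constants) (ρ : ℝ) (x₁ : Vec d) (ζ : ℕ → Ξ) {k : ℕ} (hk : 1 ≤ k) :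
    iterate p κ ρ x₁ ζ (k + 1) = proj p.X (iterate p κ ρ x₁ ζ k
      - stepSize (κ.Ltilde m) ρ k • p.estimate κ ρ x₁ ζ k) := by
  obtain ⟨k, rfl⟩ := Nat.exists_eq_add_of_le' hk
  exact run_succ_fst _ _ _ _ _ _

theorem gradErr_one (κ : Constants) (ρ : ℝ) (x₁ : Vec d) (ζ : ℕ → Ξ) :
    p.gradErr κ ρ x₁ ζ 1 = p.gradOracle x₁ (ζ 1) - gradient p.f x₁ := by
  rw [gradErr, estimate, iterate, run, oracleQ_sub_gradQ]

/-- The penalty terms are deterministic, so they cancel although `ρ_k` changes; only the noise of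
the objective oracle is left. -/
theorem gradErr_succ (κ : Constants) (ρ : ℝ) (x₁ : Vec d) (ζ : ℕ → Ξ) {k : ℕ} (hk : 1 ≤ k) :
    p.gradErr κ ρ x₁ ζ (k + 1) = (1 - momentum (k + 1)) • p.gradErr κ ρ x₁ ζ k
      + ((p.gradOracle (iterate p κ ρ x₁ ζ (k + 1)) (ζ (k + 1))
          - gradient p.f (iterate p κ ρ x₁ ζ (k + 1)))
        - (1 - momentum (k + 1)) • (p.gradOracle (iterate p κ ρ x₁ ζ k) (ζ (k + 1))
          - gradient p.f (iterate p κ ρ x₁ ζ k))) := by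
  obtain ⟨k, rfl⟩ := Nat.exists_eq_add_of_le' hk
  rw [← oracleQ_sub_gradQ (penalty ρ (k + 1 + 1)), ← oracleQ_sub_gradQ (penalty ρ (k + 1)), gradErr,
    gradErr, estimate, run_succ_snd, ← estimate, ← iterate, ← iterate]
  module

section Sampling

variable {Ω : Type*} [MeasurableSpace Ω] {μ : Measure Ω} {ξ : ℕ → Ω → Ξ}

namespace Assumptions

theorem iterate_mem (h : p.Assumptions κ) (ρ : ℝ) {x₁ : Vec d} (hx₁ : x₁ ∈ p.X) (ζ : ℕ → Ξ)
    (k : ℕ) : iterate p κ ρ x₁ ζ k ∈ p.X :=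
  h.run_mem _ _ _ hx₁ ζ k

theorem measurable_state (h : p.Assumptions κ) (hξ : ∀ k, 1 ≤ k → Measurable (ξ k)) (ρ : ℝ)
    {x₁ : Vec d} (hx₁ : x₁ ∈ p.X) {k : ℕ} (hk : 1 ≤ k) :
    Measurable (fun ω => (iterate p κ ρ x₁ (fun j => ξ j ω) k,
      p.estimate κ ρ x₁ (fun j => ξ j ω) k)) := by
  obtain ⟨k, rfl⟩ := Nat.exists_eq_add_of_le' hk
  obtain ⟨H, hH, hrun⟩ := h.exists_measurable_run (stepSize (κ.Ltilde m) ρ) (penalty ρ) momentum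
    hx₁ k
  have he : (fun ω => (iterate p κ ρ x₁ (fun j => ξ j ω) (k + 1),
      p.estimate κ ρ x₁ (fun j => ξ j ω) (k + 1)))
      = H ∘ fun ω (i : Finset.range (k + 1)) => ξ (i + 1) ω := by
    funext ω
    exact hrun fun j => ξ j ω
  rw [he]
  exact hH.comp (measurable_pi_lambda _ fun i => hξ _ (by omega))

/-- Iterate and gradient estimate are independent of the next sample. -/
theorem indepFun_state (h : p.Assumptions κ) (hs : p.IsSample μ ξ) (ρ : ℝ) {x₁ : Vec d}
    (hx₁ : x₁ ∈ p.X) {k : ℕ} (hk : 1 ≤ k) :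
    IndepFun (fun ω => (iterate p κ ρ x₁ (fun j => ξ j ω) k,
      p.estimate κ ρ x₁ (fun j => ξ j ω) k)) (ξ (k + 1)) μ := by
  obtain ⟨k, rfl⟩ := Nat.exists_eq_add_of_le' hk
  obtain ⟨H, hH, hrun⟩ := h.exists_measurable_run (stepSize (κ.Ltilde m) ρ) (penalty ρ) momentum
    hx₁ k
  have he : (fun ω => (iterate p κ ρ x₁ (fun j => ξ j ω) (k + 1),
      p.estimate κ ρ x₁ (fun j => ξ j ω) (k + 1)))
      = H ∘ fun ω (i : Finset.range (k + 1)) => ξ (i + 1) ω := by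
    funext ω
    exact hrun fun j => ξ j ω
  rw [he]
  have hi := hs.indep.indepFun_finset (Finset.range (k + 1)) {k + 1} (by simp)
    (fun i => hs.measurable _ (by omega))
  have hψ : Measurable fun z : ({k + 1} : Finset ℕ) → Ξ => z ⟨k + 1, by simp⟩ :=
    measurable_pi_apply _
  exact hi.comp hH hψ

/-- The iterates do not depend on the value of the sample sequence at `0`. -/
theorem iterate_congr (h : p.Assumptions κ) (ρ : ℝ) {x₁ : Vec d} (hx₁ : x₁ ∈ p.X)
    {ζ ζ' : ℕ → Ξ} (hζ : ∀ j, 1 ≤ j → ζ j = ζ' j) {k : ℕ} (hk : 1 ≤ k) :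
    iterate p κ ρ x₁ ζ k = iterate p κ ρ x₁ ζ' k := by
  obtain ⟨k, rfl⟩ := Nat.exists_eq_add_of_le' hk
  obtain ⟨H, -, hrun⟩ := h.exists_measurable_run (stepSize (κ.Ltilde m) ρ) (penalty ρ) momentum
    hx₁ k
  rw [iterate, iterate, hrun, hrun]
  congr 2
  funext i
  exact hζ _ (by omega)

theorem measurable_iterate (h : p.Assumptions κ) (hξ : ∀ k, 1 ≤ k → Measurable (ξ k)) (ρ : ℝ)
    {x₁ : Vec d} (hx₁ : x₁ ∈ p.X) {k : ℕ} (hk : 1 ≤ k) :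
    Measurable (fun ω => iterate p κ ρ x₁ (fun j => ξ j ω) k) :=
  (h.measurable_state hξ ρ hx₁ hk).fst

theorem measurable_gradErr (h : p.Assumptions κ) (hξ : ∀ k, 1 ≤ k → Measurable (ξ k)) (ρ : ℝ)
    {x₁ : Vec d} (hx₁ : x₁ ∈ p.X) {k : ℕ} (hk : 1 ≤ k) :
    Measurable (fun ω => p.gradErr κ ρ x₁ (fun j => ξ j ω) k) :=
  (h.measurable_state hξ ρ hx₁ hk).snd.sub
    ((h.measurable_gradQ _).comp (h.measurable_iterate hξ ρ hx₁ hk))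

theorem measurable_statGap (h : p.Assumptions κ) (hξ : ∀ k, 1 ≤ k → Measurable (ξ k)) (ρ : ℝ)
    {x₁ : Vec d} (hx₁ : x₁ ∈ p.X) {k : ℕ} (hk : 1 ≤ k) (r : ℝ) :
    Measurable (fun ω => p.statGap r (iterate p κ ρ x₁ (fun j => ξ j ω) k)) :=
  measurable_infDist_neg_normalCone h.closed
    ((h.measurable_gradQ r).comp (h.measurable_iterate hξ ρ hx₁ hk))
    (h.measurable_iterate hξ ρ hx₁ hk) fun _ => h.iterate_mem ρ hx₁ _ k

/-- Both `x_k` and `x_{k+1}` are functions of the state `(x_k, g_k)`, which is independent of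
`ξ_{k+1}`. So the one-step bound can be applied for a fixed state and then integrated. Working with
`∫⁻` avoids any prior integrability of the error. -/
theorem lintegral_gradErr_succ_le [IsProbabilityMeasure μ] (h : p.Assumptions κ)
    (hs : p.IsSample μ ξ) (ρ : ℝ) {x₁ : Vec d} (hx₁ : x₁ ∈ p.X) {k : ℕ} (hk : 1 ≤ k) :
    ∫⁻ ω, ‖p.gradErr κ ρ x₁ (fun j => ξ j ω) (k + 1)‖ₑ ^ 2 ∂μ
      ≤ ∫⁻ ω, ENNReal.ofReal (‖(1 - momentum (k + 1)) • p.gradErr κ ρ x₁ (fun j => ξ j ω) k‖ ^ 2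
        + 2 * κ.Lgf ^ 2 * ‖iterate p κ ρ x₁ (fun j => ξ j ω) (k + 1)
          - iterate p κ ρ x₁ (fun j => ξ j ω) k‖ ^ 2
        + 2 * momentum (k + 1) ^ 2 * κ.σf ^ 2) ∂μ := by
  have hm := h.measurable_state hs.measurable ρ hx₁ hk
  have hind := h.indepFun_state hs ρ hx₁ hk
  let y : Vec d × Vec d → Vec d := fun s => proj p.X (s.1 - stepSize (κ.Ltilde m) ρ k • s.2)
  have hy : Measurable y := (continuous_proj ⟨x₁, hx₁⟩ h.closed h.convex).measurable.comp
    (measurable_fst.sub (measurable_snd.const_smul (stepSize (κ.Ltilde m) ρ k)))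
  let N : Vec d × Ξ → Vec d := fun z => p.gradOracle z.1 z.2 - gradient p.f z.1
  have hN : Measurable N := h.measurable_oracle.sub ((measurable_gradient _).comp measurable_fst)
  let F : (Vec d × Vec d) × Ξ → ENNReal := fun z =>
    ‖(1 - momentum (k + 1)) • (z.1.2 - p.gradQ (penalty ρ k) z.1.1)
      + (N (y z.1, z.2) - (1 - momentum (k + 1)) • N (z.1.1, z.2))‖ₑ ^ 2
  have hF : Measurable F := by
    refine Measurable.pow_const (Measurable.enorm ?_) 2
    have h1 : Measurable fun z : (Vec d × Vec d) × Ξ => z.1.2 - p.gradQ (penalty ρ k) z.1.1 :=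
      (measurable_snd.comp measurable_fst).sub
        ((h.measurable_gradQ _).comp (measurable_fst.comp measurable_fst))
    have h2 : Measurable fun z : (Vec d × Vec d) × Ξ => N (y z.1, z.2) :=
      hN.comp ((hy.comp measurable_fst).prodMk measurable_snd)
    have h3 : Measurable fun z : (Vec d × Vec d) × Ξ => N (z.1.1, z.2) :=
      hN.comp ((measurable_fst.comp measurable_fst).prodMk measurable_snd)
    exact (h1.const_smul (1 - momentum (k + 1))).add (h2.sub (h3.const_smul (1 - momentum (k + 1))))
  refine le_trans (le_of_eq (lintegral_congr fun ω => ?_))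
    (lintegral_le_of_indepFun hm (hs.measurable (k + 1) (by omega))
      (hs.law (k + 1) (by omega)) hind hF fun ω => ?_)
  · rw [gradErr_succ κ ρ x₁ _ hk, iterate_succ κ ρ x₁ _ hk]
    rfl
  · have hb := h.lintegral_momentum_error_le
      (h.iterate_mem ρ hx₁ (fun j => ξ j ω) k) (h.iterate_mem ρ hx₁ (fun j => ξ j ω) (k + 1))
      (momentum_nonneg (k + 1)) (momentum_le_one (by omega))
      ((1 - momentum (k + 1)) • p.gradErr κ ρ x₁ (fun j => ξ j ω) k)
    rw [iterate_succ κ ρ x₁ _ hk] at hb ⊢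
    exact hb

end Assumptions

end Sampling

end Problem

/-! ### The potential argument. -/

/-- The constant of the `1 / k` term caused by the growth of the penalty parameter. -/
noncomputable def Constants.growth (κ : Constants) (m : ℕ) (ρ : ℝ) : ℝ :=
  κ.Cgf ^ 2 / (κ.δ ^ 2 * ρ) + ρ * (m * κ.Cc ^ 2) * (288 * κ.Ltilde m / κ.δ ^ 2)

/-- The constant of the `1 / k` term in the decrease of the potential. -/
noncomputable def Constants.drift (κ : Constants) (m : ℕ) (ρ : ℝ) : ℝ :=
  κ.growth m ρ + κ.σf ^ 2 / (4 * κ.Ltilde m * ρ)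

/-- A bound for the range of the potential. -/
noncomputable def Constants.range (κ : Constants) (m : ℕ) (ρ : ℝ) : ℝ :=
  2 * κ.Bf + ρ / 2 * (m * κ.Cc ^ 2) + κ.σf ^ 2 / (8 * κ.Ltilde m * ρ)

/-- The constant in the bound for the sum of the squared stationarity gaps. -/
noncomputable def Constants.rate (κ : Constants) (m : ℕ) (ρ : ℝ) : ℝ :=
  288 * κ.Ltilde m * ρ * (κ.range m ρ + κ.drift m ρ)

theorem Constants.growth_nonneg (κ : Constants) {m : ℕ} (hL : 0 < κ.Ltilde m) {ρ : ℝ}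
    (hρ : 1 < ρ) : 0 ≤ κ.growth m ρ := by
  rw [growth]; positivity

theorem Constants.drift_nonneg (κ : Constants) {m : ℕ} (hL : 0 < κ.Ltilde m) {ρ : ℝ}
    (hρ : 1 < ρ) : 0 ≤ κ.drift m ρ := by
  have := κ.growth_nonneg hL hρ
  rw [drift]; positivity

theorem Constants.range_nonneg (κ : Constants) {m : ℕ} (hL : 0 < κ.Ltilde m) {ρ : ℝ}
    (hρ : 1 < ρ) : 0 ≤ κ.range m ρ := by
  have := κ.Bf_nonneg
  rw [range]; positivity

theorem Constants.Lgf_sq_le (κ : Constants) (m : ℕ) : κ.Lgf ^ 2 ≤ κ.Ltilde m ^ 2 / 4 := by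
  rw [Ltilde, Real.sq_sqrt (by positivity)]
  have : 0 ≤ (m : ℝ) ^ 2 * (κ.Cc ^ 2 * κ.Lgc ^ 2 + κ.Cgc ^ 2 * κ.Lc ^ 2) := by positivity
  linarith

theorem sum_inv_Icc_le (K : ℕ) : ∑ k ∈ Finset.Icc 1 K, (1 : ℝ) / k ≤ 1 + Real.log K := by
  have h := harmonic_le_one_add_log K
  rw [harmonic_eq_sum_Icc] at h
  push_cast at h
  simpa using h

/-- Telescoping a potential inequality. -/
theorem sum_le_of_potential {Φ a b : ℕ → ℝ} (h : ∀ k, 1 ≤ k → Φ (k + 1) + a k ≤ Φ k + b k)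
    (K : ℕ) :
    Φ (K + 1) + ∑ k ∈ Finset.Icc 1 K, a k ≤ Φ 1 + ∑ k ∈ Finset.Icc 1 K, b k := by
  induction K with
  | zero => simp
  | succ K ih =>
    rw [Finset.sum_Icc_succ_top (by omega), Finset.sum_Icc_succ_top (by omega)]
    linarith [h (K + 1) (by omega)]

namespace Problem

variable {d m : ℕ} {Ξ : Type*} [MeasurableSpace Ξ] {p : Problem d m Ξ} {κ : Constants}
  {Ω : Type*} [MeasurableSpace Ω] {μ : Measure Ω} {ξ : ℕ → Ω → Ξ} {ρ : ℝ} {x₁ : Vec d}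

/-- The potential `E Q_{ρ_k}(x_k) + E ‖g_k - ∇Q_{ρ_k}(x_k)‖² / (8 L̃ ρ)`. -/
noncomputable def potential (p : Problem d m Ξ) (κ : Constants)
    (μ : Measure Ω) (ξ : ℕ → Ω → Ξ) (ρ : ℝ) (x₁ : Vec d) (k : ℕ) : ℝ :=
  ∫ ω, p.Q (penalty ρ k) (iterate p κ ρ x₁ (fun j => ξ j ω) k) ∂μ
    + 1 / (8 * κ.Ltilde m * ρ) * ∫ ω, ‖p.gradErr κ ρ x₁ (fun j => ξ j ω) k‖ ^ 2 ∂μ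

namespace Assumptions

theorem norm_c_sq (x : Vec d) : ∑ i, p.c x i ^ 2 = ‖p.c x‖ ^ 2 :=
  (EuclideanSpace.real_norm_sq_eq _).symm

/-- The decrease of the penalty function along one step of the method. -/
theorem ae_Q_succ_le (h : p.Assumptions κ) (hL : 0 < κ.Ltilde m) (hρ : 1 < ρ) (hx₁ : x₁ ∈ p.X)
    (hI : p.IterateAssumptions κ μ fun k ω => iterate p κ ρ x₁ (fun j => ξ j ω) k)
    {k : ℕ} (hk : 1 ≤ k) :
    ∀ᵐ ω ∂μ, p.Q (penalty ρ (k + 1)) (iterate p κ ρ x₁ (fun j => ξ j ω) (k + 1))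
        + stepSize (κ.Ltilde m) ρ k / 16
          * p.statGap (penalty ρ k) (iterate p κ ρ x₁ (fun j => ξ j ω) (k + 1)) ^ 2
        + 1 / (144 * stepSize (κ.Ltilde m) ρ k) * ‖iterate p κ ρ x₁ (fun j => ξ j ω) (k + 1)
            - iterate p κ ρ x₁ (fun j => ξ j ω) k‖ ^ 2
      ≤ p.Q (penalty ρ k) (iterate p κ ρ x₁ (fun j => ξ j ω) k)
        + stepSize (κ.Ltilde m) ρ k * ‖p.gradErr κ ρ x₁ (fun j => ξ j ω) k‖ ^ 2
        + κ.growth m ρ / k := by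
  filter_upwards [hI.regular (k + 1) (by omega)] with ω hreg
  have hr := one_le_penalty hρ hk
  have h1 := h.Q_proj_add_le (g := p.estimate κ ρ x₁ (fun j => ξ j ω) k)
    (h.iterate_mem ρ hx₁ (fun j => ξ j ω) k) (stepSize_pos hL hρ k) hr hL.le
    (mul_penalty_le hL hρ hk)
  rw [← iterate_succ κ ρ x₁ _ hk] at h1
  have hmem := h.iterate_mem ρ hx₁ (fun j => ξ j ω) (k + 1)
  have h2 := h.mul_norm_c_le hmem (zero_lt_one.trans_le hr) hreg
  have h3 := penalty_growth_le hL hρ κ.δ_pos (norm_nonneg _) (h.norm_c_sq_le hmem) hk h2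
  have h4 : p.Q (penalty ρ (k + 1)) (iterate p κ ρ x₁ (fun j => ξ j ω) (k + 1))
      = p.Q (penalty ρ k) (iterate p κ ρ x₁ (fun j => ξ j ω) (k + 1))
        + (penalty ρ (k + 1) - penalty ρ k) / 2
          * ‖p.c (iterate p κ ρ x₁ (fun j => ξ j ω) (k + 1))‖ ^ 2 := by
    rw [Q, Q, norm_c_sq]; ring
  rw [h4, Constants.growth]
  rw [← gradErr] at h1
  linarith

theorem integrable_Q [IsProbabilityMeasure μ] (h : p.Assumptions κ) (hs : p.IsSample μ ξ)
    (hx₁ : x₁ ∈ p.X)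
    (hI : p.IterateAssumptions κ μ fun k ω => iterate p κ ρ x₁ (fun j => ξ j ω) k)
    {k : ℕ} (hk : 1 ≤ k) {r : ℝ} (hr : 0 ≤ r) :
    Integrable (fun ω => p.Q r (iterate p κ ρ x₁ (fun j => ξ j ω) k)) μ := by
  refine Integrable.mono' (integrable_const (κ.Bf + r / 2 * (m * κ.Cc ^ 2)))
    ((h.measurable_Q r).comp (h.measurable_iterate hs.measurable ρ hx₁ hk)).aestronglyMeasurable ?_
  filter_upwards [hI.bound_f k hk] with ω hf
  exact h.abs_Q_le hr (h.iterate_mem ρ hx₁ _ k) hf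

/-- No moment bound on the iterates is assumed. The descent inequality itself dominates both squares
by bounded values of `Q` and the squared error. -/
theorem integrable_step_statGap [IsProbabilityMeasure μ] (h : p.Assumptions κ)
    (hs : p.IsSample μ ξ) (hL : 0 < κ.Ltilde m) (hρ : 1 < ρ) (hx₁ : x₁ ∈ p.X)
    (hI : p.IterateAssumptions κ μ fun k ω => iterate p κ ρ x₁ (fun j => ξ j ω) k)
    {k : ℕ} (hk : 1 ≤ k) (he : MemLp (fun ω => p.gradErr κ ρ x₁ (fun j => ξ j ω) k) 2 μ) :
    Integrable (fun ω => ‖iterate p κ ρ x₁ (fun j => ξ j ω) (k + 1)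
      - iterate p κ ρ x₁ (fun j => ξ j ω) k‖ ^ 2) μ ∧
    Integrable (fun ω =>
      p.statGap (penalty ρ k) (iterate p κ ρ x₁ (fun j => ξ j ω) (k + 1)) ^ 2) μ := by
  have hη := stepSize_pos hL hρ k
  set η := stepSize (κ.Ltilde m) ρ k with hηdef
  have hp : ∀ {k}, 1 ≤ k → 0 ≤ penalty ρ k := fun hk => by linarith [one_le_penalty hρ hk]
  have hB := ((h.integrable_Q hs hx₁ hI hk (hp hk)).add
    ((integrable_norm_sq he).const_mul η)).add (integrable_const (κ.growth m ρ / k))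
  have hB' := hB.sub (h.integrable_Q hs hx₁ hI (k := k + 1) (by omega)
    (hp (k := k + 1) (by omega)))
  have hae := h.ae_Q_succ_le hL hρ hx₁ hI hk
  constructor
  · refine Integrable.mono' (hB'.const_mul (144 * η)) (((h.measurable_iterate hs.measurable ρ hx₁
      (by omega)).sub (h.measurable_iterate hs.measurable ρ hx₁ hk)).norm.pow_const 2).aestronglyMeasurable ?_
    filter_upwards [hae] with ω hω
    rw [← hηdef] at hω
    rw [Real.norm_eq_abs, abs_of_nonneg (by positivity)]
    refine le_of_mul_le_mul_left (a := 1 / (144 * η)) ?_ (by positivity)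
    rw [← mul_assoc (1 / (144 * η)), one_div_mul_cancel (by positivity), one_mul]
    have : 0 ≤ η / 16
      * p.statGap (penalty ρ k) (iterate p κ ρ x₁ (fun j => ξ j ω) (k + 1)) ^ 2 := by positivity
    simp only [Pi.sub_apply, Pi.add_apply]
    linarith
  · refine Integrable.mono' (hB'.const_mul (16 / η)) ((h.measurable_statGap hs.measurable ρ hx₁
      (by omega) _).pow_const 2).aestronglyMeasurable ?_
    filter_upwards [hae] with ω hω
    rw [← hηdef] at hω
    rw [Real.norm_eq_abs, abs_of_nonneg (by positivity)]
    refine le_of_mul_le_mul_left (a := η / 16) ?_ (by positivity)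
    rw [← mul_assoc (η / 16), div_mul_div_cancel₀ (by norm_num), div_self hη.ne', one_mul]
    have : 0 ≤ 1 / (144 * η) * ‖iterate p κ ρ x₁ (fun j => ξ j ω) (k + 1)
            - iterate p κ ρ x₁ (fun j => ξ j ω) k‖ ^ 2 := by positivity
    simp only [Pi.sub_apply, Pi.add_apply]
    linarith

theorem lintegral_gradErr_one_le (h : p.Assumptions κ) (hs : p.IsSample μ ξ) (hx₁ : x₁ ∈ p.X) :
    ∫⁻ ω, ‖p.gradErr κ ρ x₁ (fun j => ξ j ω) 1‖ₑ ^ 2 ∂μ ≤ ENNReal.ofReal (κ.σf ^ 2) := by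
  have h1 := h.variance x₁ hx₁
  have hm : Measurable fun ζ => ‖p.gradOracle x₁ ζ - gradient p.f x₁‖ₑ ^ 2 :=
    ((h.measurable_oracle_apply x₁).sub measurable_const).enorm.pow_const 2
  rw [← hs.law 1 le_rfl, lintegral_map hm (hs.measurable 1 le_rfl)] at h1
  simpa only [gradErr_one] using h1

theorem integrable_error_bound [IsProbabilityMeasure μ] {e D : Ω → Vec d} (he : MemLp e 2 μ)
    (hD : Integrable (fun ω => ‖D ω‖ ^ 2) μ) (a b c : ℝ) :
    Integrable (fun ω => ‖a • e ω‖ ^ 2 + b * ‖D ω‖ ^ 2 + c) μ :=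
  ((integrable_norm_sq (he.const_smul a)).add (hD.const_mul b)).add (integrable_const c)

theorem memLp_gradErr [IsProbabilityMeasure μ] (h : p.Assumptions κ)
    (hs : p.IsSample μ ξ) (hL : 0 < κ.Ltilde m) (hρ : 1 < ρ) (hx₁ : x₁ ∈ p.X)
    (hI : p.IterateAssumptions κ μ fun k ω => iterate p κ ρ x₁ (fun j => ξ j ω) k)
    {k : ℕ} (hk : 1 ≤ k) : MemLp (fun ω => p.gradErr κ ρ x₁ (fun j => ξ j ω) k) 2 μ := by
  induction k, hk using Nat.le_induction with
  | base =>
    exact memLp_two_of_lintegral_le (h.measurable_gradErr hs.measurable ρ hx₁ le_rfl).aestronglyMeasurable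
      (h.lintegral_gradErr_one_le hs hx₁)
  -- Integrability is bootstrapped: a square-integrable error gives a square-integrable step, which
  -- gives a square-integrable next error.
  | succ k hk ih =>
    have hD := (h.integrable_step_statGap hs hL hρ hx₁ hI hk ih).1
    have h1 := h.lintegral_gradErr_succ_le hs ρ hx₁ hk
    rw [← ofReal_integral_eq_lintegral_ofReal (integrable_error_bound ih hD _ _ _)
      (ae_of_all _ fun ω => by positivity)] at h1
    exact memLp_two_of_lintegral_le
      (h.measurable_gradErr hs.measurable ρ hx₁ (by omega)).aestronglyMeasurable h1

/-- The recursion for the second moment of the error of the gradient estimate. -/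
theorem integral_gradErr_succ_le [IsProbabilityMeasure μ] (h : p.Assumptions κ)
    (hs : p.IsSample μ ξ) (hL : 0 < κ.Ltilde m) (hρ : 1 < ρ) (hx₁ : x₁ ∈ p.X)
    (hI : p.IterateAssumptions κ μ fun k ω => iterate p κ ρ x₁ (fun j => ξ j ω) k)
    {k : ℕ} (hk : 1 ≤ k) :
    ∫ ω, ‖p.gradErr κ ρ x₁ (fun j => ξ j ω) (k + 1)‖ ^ 2 ∂μ
      ≤ (1 - momentum (k + 1)) ^ 2 * ∫ ω, ‖p.gradErr κ ρ x₁ (fun j => ξ j ω) k‖ ^ 2 ∂μ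
        + 2 * κ.Lgf ^ 2 * ∫ ω, ‖iterate p κ ρ x₁ (fun j => ξ j ω) (k + 1)
          - iterate p κ ρ x₁ (fun j => ξ j ω) k‖ ^ 2 ∂μ
        + 2 * momentum (k + 1) ^ 2 * κ.σf ^ 2 := by
  have he := h.memLp_gradErr hs hL hρ hx₁ hI hk
  have hD := (h.integrable_step_statGap hs hL hρ hx₁ hI hk he).1
  have h1 := h.lintegral_gradErr_succ_le hs ρ hx₁ hk
  rw [← ofReal_integral_eq_lintegral_ofReal (integrable_error_bound he hD _ _ _)
    (ae_of_all _ fun ω => by positivity)] at h1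
  have h2 := integral_norm_sq_le
    (h.measurable_gradErr hs.measurable ρ hx₁ (k := k + 1) (by omega)).aestronglyMeasurable
    (integral_nonneg fun ω => by positivity) h1
  refine h2.trans (le_of_eq ?_)
  have hi : Integrable (fun ω => (1 - momentum (k + 1)) ^ 2
      * ‖p.gradErr κ ρ x₁ (fun j => ξ j ω) k‖ ^ 2) μ := (integrable_norm_sq he).const_mul _
  have hj := hD.const_mul (2 * κ.Lgf ^ 2)
  have hij : Integrable (fun ω => (1 - momentum (k + 1)) ^ 2
      * ‖p.gradErr κ ρ x₁ (fun j => ξ j ω) k‖ ^ 2 + 2 * κ.Lgf ^ 2 *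
      ‖iterate p κ ρ x₁ (fun j => ξ j ω) (k + 1) - iterate p κ ρ x₁ (fun j => ξ j ω) k‖ ^ 2) μ :=
    hi.add hj
  simp_rw [norm_smul, mul_pow, Real.norm_eq_abs, sq_abs]
  rw [integral_add hij (integrable_const _), integral_add hi hj, integral_const_mul,
    integral_const_mul]
  simp

/-- The descent of the penalty function is added to the error recursion divided by `8 L̃ ρ`; the
error and movement terms cancel, which leaves the gap and an `O(1/k)` drift. -/
theorem potential_succ_le [IsProbabilityMeasure μ] (h : p.Assumptions κ)
    (hs : p.IsSample μ ξ) (hL : 0 < κ.Ltilde m) (hρ : 1 < ρ) (hx₁ : x₁ ∈ p.X)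
    (hI : p.IterateAssumptions κ μ fun k ω => iterate p κ ρ x₁ (fun j => ξ j ω) k)
    {k : ℕ} (hk : 1 ≤ k) :
    p.potential κ μ ξ ρ x₁ (k + 1) + stepSize (κ.Ltilde m) ρ k / 16 *
        ∫ ω, p.statGap (penalty ρ k) (iterate p κ ρ x₁ (fun j => ξ j ω) (k + 1)) ^ 2 ∂μ
      ≤ p.potential κ μ ξ ρ x₁ k + κ.drift m ρ * (1 / k) := by
  have he := h.memLp_gradErr hs hL hρ hx₁ hI hk
  obtain ⟨hD, hS⟩ := h.integrable_step_statGap hs hL hρ hx₁ hI hk he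
  have hp : ∀ {k}, 1 ≤ k → 0 ≤ penalty ρ k := fun hk => by linarith [one_le_penalty hρ hk]
  have hQ := h.integrable_Q hs hx₁ hI hk (hp hk)
  have hQ' := h.integrable_Q hs hx₁ hI (k := k + 1) (by omega) (hp (k := k + 1) (by omega))
  have hη := stepSize_pos hL hρ k
  have hα := momentum_succ_eq hL hρ k
  have hα0 := momentum_nonneg (k + 1)
  have hα1 := momentum_le_one (k := k + 1) (by omega)
  have hV := h.integral_gradErr_succ_le hs hL hρ hx₁ hI hk
  have hLη : κ.Ltilde m ≤ 1 / (9 * stepSize (κ.Ltilde m) ρ k) :=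
    (le_mul_of_one_le_right hL.le (one_le_penalty hρ hk)).trans (mul_penalty_le hL hρ hk)
  have hi1 := hS.const_mul (stepSize (κ.Ltilde m) ρ k / 16)
  have hi2 := hD.const_mul (1 / (144 * stepSize (κ.Ltilde m) ρ k))
  have hi3 := (integrable_norm_sq he).const_mul (stepSize (κ.Ltilde m) ρ k)
  have hm := integral_mono_ae ((hQ'.add hi1).add hi2) ((hQ.add hi3).add (integrable_const _))
    (h.ae_Q_succ_le hL hρ hx₁ hI hk)
  rw [integral_add' (hQ'.add hi1) hi2, integral_add' hQ' hi1,
    integral_add' (hQ.add hi3) (integrable_const _), integral_add' hQ hi3,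
    integral_const_mul, integral_const_mul, integral_const_mul] at hm
  simp only [integral_const, probReal_univ, one_smul] at hm
  rw [potential, potential]
  have hD0 : 0 ≤ ∫ ω, ‖iterate p κ ρ x₁ (fun j => ξ j ω) (k + 1)
      - iterate p κ ρ x₁ (fun j => ξ j ω) k‖ ^ 2 ∂μ := integral_nonneg fun ω => by positivity
  have hV0 : 0 ≤ ∫ ω, ‖p.gradErr κ ρ x₁ (fun j => ξ j ω) k‖ ^ 2 ∂μ :=
    integral_nonneg fun ω => by positivity
  set V := ∫ ω, ‖p.gradErr κ ρ x₁ (fun j => ξ j ω) k‖ ^ 2 ∂μ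
  set V' := ∫ ω, ‖p.gradErr κ ρ x₁ (fun j => ξ j ω) (k + 1)‖ ^ 2 ∂μ
  set D := ∫ ω, ‖iterate p κ ρ x₁ (fun j => ξ j ω) (k + 1)
      - iterate p κ ρ x₁ (fun j => ξ j ω) k‖ ^ 2 ∂μ
  set S := ∫ ω, p.statGap (penalty ρ k) (iterate p κ ρ x₁ (fun j => ξ j ω) (k + 1)) ^ 2 ∂μ
  set q := ∫ ω, p.Q (penalty ρ k) (iterate p κ ρ x₁ (fun j => ξ j ω) k) ∂μ
  set q' := ∫ ω, p.Q (penalty ρ (k + 1)) (iterate p κ ρ x₁ (fun j => ξ j ω) (k + 1)) ∂μ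
  set η := stepSize (κ.Ltilde m) ρ k
  set L := κ.Ltilde m
  set α := momentum (k + 1)
  have hA : 0 < 8 * L * ρ := by positivity
  -- `(1 - α)² ≤ 1 - α`, and `α / (8 L ρ) = η`.
  have h1 : 1 / (8 * L * ρ) * ((1 - α) ^ 2 * V) ≤ 1 / (8 * L * ρ) * V - η * V := by
    have : 1 / (8 * L * ρ) * V - η * V = 1 / (8 * L * ρ) * ((1 - α) * V) := by
      rw [hα]; field_simp
    rw [this]
    gcongr
    nlinarith
  -- Uses `L_{∇f}² ≤ L̃² / 4` and `L̃ ≤ 1/(9η)`; the result `1/(144η)` is exactly the movement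
  -- coefficient in the descent.
  have h2 : 1 / (8 * L * ρ) * (2 * κ.Lgf ^ 2 * D) ≤ 1 / (144 * η) * D := by
    rw [← mul_assoc]
    gcongr
    calc 1 / (8 * L * ρ) * (2 * κ.Lgf ^ 2) ≤ 1 / (8 * L * ρ) * (2 * (L ^ 2 / 4)) := by
          gcongr; exact κ.Lgf_sq_le m
      _ = 1 / 16 * (L / ρ) := by field_simp; norm_num
      _ ≤ 1 / 16 * L := by gcongr; exact div_le_self hL.le hρ.le
      _ ≤ 1 / 16 * (1 / (9 * η)) := by gcongr
      _ = _ := by field_simp; norm_num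
  have h3 : 1 / (8 * L * ρ) * (2 * α ^ 2 * κ.σf ^ 2) ≤ κ.σf ^ 2 / (4 * L * ρ) * (1 / k) := by
    have hk' : (1 : ℝ) ≤ k := by exact_mod_cast hk
    have : α ^ 2 ≤ 1 / k := by
      rw [momentum_sq]; push_cast
      rw [div_le_div_iff₀ (by positivity) (by positivity)]; linarith
    calc 1 / (8 * L * ρ) * (2 * α ^ 2 * κ.σf ^ 2)
        ≤ 1 / (8 * L * ρ) * (2 * (1 / k) * κ.σf ^ 2) := by gcongr
      _ = _ := by field_simp; ring
  have h4 := mul_le_mul_of_nonneg_left hV (by positivity : 0 ≤ 1 / (8 * L * ρ))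
  rw [mul_add, mul_add] at h4
  have h5 : κ.drift m ρ * (1 / k) = κ.growth m ρ / k + κ.σf ^ 2 / (4 * L * ρ) * (1 / k) := by
    rw [Constants.drift]; ring
  rw [h5]
  linarith

theorem potential_one_le [IsProbabilityMeasure μ] (h : p.Assumptions κ)
    (hs : p.IsSample μ ξ) (hL : 0 < κ.Ltilde m) (hρ : 1 < ρ) (hx₁ : x₁ ∈ p.X)
    (hI : p.IterateAssumptions κ μ fun k ω => iterate p κ ρ x₁ (fun j => ξ j ω) k) :
    p.potential κ μ ξ ρ x₁ 1
      ≤ κ.Bf + ρ / 2 * (m * κ.Cc ^ 2) + κ.σf ^ 2 / (8 * κ.Ltilde m * ρ) := by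
  have hp : penalty ρ 1 = ρ := by simp [penalty]
  have h1 : ∫ ω, p.Q (penalty ρ 1) (iterate p κ ρ x₁ (fun j => ξ j ω) 1) ∂μ
      ≤ ∫ _, (κ.Bf + ρ / 2 * (m * κ.Cc ^ 2)) ∂μ := by
    refine integral_mono_ae (h.integrable_Q hs hx₁ hI le_rfl (by rw [hp]; linarith))
      (integrable_const _) ?_
    filter_upwards [hI.bound_f 1 le_rfl] with ω hf
    rw [hp]
    exact (abs_le.1 (h.abs_Q_le (by linarith) (h.iterate_mem ρ hx₁ _ 1) hf)).2
  have h2 := integral_norm_sq_le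
    (h.measurable_gradErr hs.measurable ρ hx₁ (k := 1) le_rfl).aestronglyMeasurable (sq_nonneg _)
    (h.lintegral_gradErr_one_le hs hx₁)
  simp only [integral_const, probReal_univ, one_smul] at h1
  rw [potential]
  refine add_le_add h1 ?_
  rw [div_eq_mul_one_div (κ.σf ^ 2), mul_comm (κ.σf ^ 2)]
  gcongr

theorem le_potential [IsProbabilityMeasure μ] (h : p.Assumptions κ)
    (hs : p.IsSample μ ξ) (hL : 0 < κ.Ltilde m) (hρ : 1 < ρ) (hx₁ : x₁ ∈ p.X)
    (hI : p.IterateAssumptions κ μ fun k ω => iterate p κ ρ x₁ (fun j => ξ j ω) k)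
    {k : ℕ} (hk : 1 ≤ k) : -κ.Bf ≤ p.potential κ μ ξ ρ x₁ k := by
  have hp : 0 ≤ penalty ρ k := by linarith [one_le_penalty hρ hk]
  have h1 : ∫ _, -κ.Bf ∂μ ≤ ∫ ω, p.Q (penalty ρ k) (iterate p κ ρ x₁ (fun j => ξ j ω) k) ∂μ := by
    refine integral_mono_ae (integrable_const _) (h.integrable_Q hs hx₁ hI hk hp) ?_
    filter_upwards [hI.bound_f k hk] with ω hf
    have hc : 0 ≤ penalty ρ k / 2 * ∑ i, p.c (iterate p κ ρ x₁ (fun j => ξ j ω) k) i ^ 2 := by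
      positivity
    rw [Q]
    linarith [(abs_le.1 hf).1]
  simp only [integral_const, probReal_univ, one_smul] at h1
  have h2 : 0 ≤ 1 / (8 * κ.Ltilde m * ρ) * ∫ ω, ‖p.gradErr κ ρ x₁ (fun j => ξ j ω) k‖ ^ 2 ∂μ :=
    mul_nonneg (by positivity) (integral_nonneg fun ω => by positivity)
  rw [potential]
  linarith

/-- The sum of the expected squared stationarity gaps grows at most like `√K log K`. -/
theorem sum_integral_statGap_sq_le [IsProbabilityMeasure μ] (h : p.Assumptions κ)
    (hs : p.IsSample μ ξ) (hL : 0 < κ.Ltilde m) (hρ : 1 < ρ) (hx₁ : x₁ ∈ p.X)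
    (hI : p.IterateAssumptions κ μ fun k ω => iterate p κ ρ x₁ (fun j => ξ j ω) k)
    {K : ℕ} (hK : 1 ≤ K) :
    ∑ k ∈ Finset.Icc 1 K,
        ∫ ω, p.statGap (penalty ρ k) (iterate p κ ρ x₁ (fun j => ξ j ω) (k + 1)) ^ 2 ∂μ
      ≤ κ.rate m ρ * (1 + Real.log K) * √K := by
  have hK' : (1 : ℝ) ≤ K := by exact_mod_cast hK
  have hη := stepSize_pos hL hρ K
  have hlog : 0 ≤ Real.log K := Real.log_nonneg hK'
  have h1 := sum_le_of_potential (fun k hk => h.potential_succ_le hs hL hρ hx₁ hI hk) K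
  have h2 := h.potential_one_le hs hL hρ hx₁ hI
  have h3 := h.le_potential hs hL hρ hx₁ hI (k := K + 1) (by omega)
  rw [← Finset.mul_sum] at h1
  have h4 := mul_le_mul_of_nonneg_left (sum_inv_Icc_le K) (κ.drift_nonneg hL hρ)
  have h5 : stepSize (κ.Ltilde m) ρ K / 16 * ∑ k ∈ Finset.Icc 1 K,
        ∫ ω, p.statGap (penalty ρ k) (iterate p κ ρ x₁ (fun j => ξ j ω) (k + 1)) ^ 2 ∂μ
      ≤ ∑ k ∈ Finset.Icc 1 K, stepSize (κ.Ltilde m) ρ k / 16 *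
        ∫ ω, p.statGap (penalty ρ k) (iterate p κ ρ x₁ (fun j => ξ j ω) (k + 1)) ^ 2 ∂μ := by
    rw [Finset.mul_sum]
    refine Finset.sum_le_sum fun k hk => ?_
    have hk' : (k : ℝ) ≤ K := by exact_mod_cast (Finset.mem_Icc.1 hk).2
    have hle : stepSize (κ.Ltilde m) ρ K ≤ stepSize (κ.Ltilde m) ρ k := by
      rw [stepSize, stepSize]; gcongr
    have h0 : 0 ≤ ∫ ω, p.statGap (penalty ρ k)
        (iterate p κ ρ x₁ (fun j => ξ j ω) (k + 1)) ^ 2 ∂μ := integral_nonneg fun ω => sq_nonneg _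
    gcongr
  set T := ∑ k ∈ Finset.Icc 1 K,
        ∫ ω, p.statGap (penalty ρ k) (iterate p κ ρ x₁ (fun j => ξ j ω) (k + 1)) ^ 2 ∂μ
  have hR := κ.range_nonneg hL hρ
  have hd := κ.drift_nonneg hL hρ
  have h6 : stepSize (κ.Ltilde m) ρ K / 16 * T
      ≤ (κ.range m ρ + κ.drift m ρ) * (1 + Real.log K) := by
    have : stepSize (κ.Ltilde m) ρ K / 16 * T
        ≤ κ.range m ρ + κ.drift m ρ * (1 + Real.log K) := by
      rw [Constants.range]; linarith
    nlinarith
  -- `√(K + 1) ≤ 2√K` gives `18 = 9 · 2`; with the factor `1/16` of the gap this becomes the `288`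
  -- in `Constants.rate`.
  have h7 : 1 / (18 * κ.Ltilde m * ρ * √K) ≤ stepSize (κ.Ltilde m) ρ K := by
    have : ((K : ℝ) + 1) ^ (1 / 2 : ℝ) ≤ 2 * √K := by
      rw [← Real.sqrt_eq_rpow]
      refine Real.sqrt_le_iff.2 ⟨by positivity, ?_⟩
      rw [mul_pow, Real.sq_sqrt (by positivity)]; linarith
    rw [stepSize]
    refine one_div_le_one_div_of_le (by positivity) ?_
    calc 9 * κ.Ltilde m * ρ * ((K : ℝ) + 1) ^ (1 / 2 : ℝ)
        ≤ 9 * κ.Ltilde m * ρ * (2 * √K) := by gcongr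
      _ = _ := by ring
  have hT : 0 ≤ T := Finset.sum_nonneg fun k _ => integral_nonneg fun ω => sq_nonneg _
  have hsq : 0 < √(K : ℝ) := Real.sqrt_pos.2 (by linarith)
  have h8 : 1 / (18 * κ.Ltilde m * ρ * √K) / 16 * T
      ≤ (κ.range m ρ + κ.drift m ρ) * (1 + Real.log K) := le_trans (by gcongr) h6
  calc T = 288 * κ.Ltilde m * ρ * √K * (1 / (18 * κ.Ltilde m * ρ * √K) / 16 * T) := by
        field_simp; ring
    _ ≤ 288 * κ.Ltilde m * ρ * √K * ((κ.range m ρ + κ.drift m ρ) * (1 + Real.log K)) := by gcongr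
    _ = _ := by rw [Constants.rate]; ring

end Assumptions

end Problem

/-! ### From the convergence rate to the iteration count. -/

theorem sum_inv_rpow_quarter_le (K : ℕ) :
    ∑ k ∈ Finset.Icc 1 K, 1 / (k : ℝ) ^ (1 / 4 : ℝ) ≤ 2 * ((K : ℝ) ^ (1 / 4 : ℝ)) ^ 3 := by
  induction K with
  | zero => simp
  | succ K ih =>
    rw [Finset.sum_Icc_succ_top (by omega)]
    have h1 := one_le_rpow_quarter (k := K + 1) (by omega)
    have h2 := rpow_quarter_le_succ K
    have h3 := rpow_quarter_pow_four K
    have h4 := rpow_quarter_pow_four (K + 1)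
    have h0 : (0 : ℝ) ≤ (K : ℝ) ^ (1 / 4 : ℝ) := by positivity
    set t := (K : ℝ) ^ (1 / 4 : ℝ)
    set s := ((K + 1 : ℕ) : ℝ) ^ (1 / 4 : ℝ)
    have hst : s ^ 4 = t ^ 4 + 1 := by rw [h4, h3]; push_cast; rfl
    have hs : 0 < s := by linarith
    -- With `1 = s⁴ - t⁴` this is `2t³s ≤ s⁴ + t⁴`, which follows from `(s² - t²)² ≥ 0` and `t ≤ s`.
    have h5 : 1 / s ≤ 2 * s ^ 3 - 2 * t ^ 3 := by
      rw [div_le_iff₀ hs]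
      have h6 : 0 ≤ t ^ 2 * s * (s - t) := by
        have := sub_nonneg.2 h2; positivity
      nlinarith [sq_nonneg (s ^ 2 - t ^ 2)]
    linarith

/-- From `K ≥ C ε⁻⁴ (1 + log (1/ε))²` on, the ratio `(1 + log K) / √K` is at most `ε² / M`. -/
theorem exists_threshold {M : ℝ} (hM : 0 ≤ M) :
    ∃ C : ℝ, 1 ≤ C ∧ ∀ ε : ℝ, 0 < ε → ε ≤ 1 → ∀ K : ℕ,
      C * (1 / ε) ^ 4 * (1 + Real.log (1 / ε)) ^ 2 ≤ K → M * (1 + Real.log K) ≤ ε ^ 2 * √K := by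
  refine ⟨(11 * M) ^ 4 + 1, by have : 0 ≤ (11 * M) ^ 4 := by positivity
                               linarith, fun ε hε hε1 K hK => ?_⟩
  have hE : 1 ≤ 1 / ε := by rw [le_div_iff₀ hε]; linarith
  have hlogE : 0 ≤ Real.log (1 / ε) := Real.log_nonneg hE
  obtain ⟨W, hW⟩ : ∃ W, W = 1 + Real.log (1 / ε) := ⟨_, rfl⟩
  have hW1 : 1 ≤ W := by linarith
  rw [← hW] at hK
  have hεE : ε ^ 2 * (1 / ε) ^ 2 = 1 := by field_simp
  set E := 1 / ε
  -- Writing `K = v⁴E⁴W²` makes `ε²√K = v²W`, while `1 + log K` grows at most like `11vW`; so `v ≥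
  -- 11M` is enough.
  obtain ⟨v, hv0, hv⟩ : ∃ v : ℝ, 0 ≤ v ∧ v ^ 4 = K / (E ^ 4 * W ^ 2) := by
    refine ⟨√√(K / (E ^ 4 * W ^ 2)), by positivity, ?_⟩
    rw [show (4 : ℕ) = 2 * 2 from rfl, pow_mul, Real.sq_sqrt (by positivity),
      Real.sq_sqrt (by positivity)]
  have hKv : (K : ℝ) = v ^ 4 * E ^ 4 * W ^ 2 := by rw [hv]; field_simp
  have hv4 : (11 * M) ^ 4 + 1 ≤ v ^ 4 := by
    rw [hv, le_div_iff₀ (by positivity)]; linarith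
  have hv1 : 1 ≤ v := by
    have : 0 ≤ (11 * M) ^ 4 := by positivity
    exact le_of_pow_le_pow_left₀ (n := 4) (by norm_num) hv0 (by linarith)
  have hvM : 11 * M ≤ v := le_of_pow_le_pow_left₀ (n := 4) (by norm_num) hv0 (by linarith)
  have hsqrt : √(K : ℝ) = v ^ 2 * E ^ 2 * W := by
    rw [hKv, Real.sqrt_eq_iff_mul_self_eq (by positivity) (by positivity)]; ring
  have hlog : Real.log K = 4 * Real.log v + 4 * Real.log E + 2 * Real.log W := by
    rw [hKv, Real.log_mul (by positivity) (by positivity),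
      Real.log_mul (by positivity) (by positivity), Real.log_pow, Real.log_pow, Real.log_pow]
    norm_num
  have hlv := Real.log_le_sub_one_of_pos (x := v) (by linarith)
  have hlW := Real.log_le_sub_one_of_pos (x := W) (by linarith)
  have h1 : 1 + Real.log K ≤ 11 * v * W := by
    rw [hlog]
    nlinarith [mul_nonneg (sub_nonneg.2 hv1) (sub_nonneg.2 hW1)]
  calc M * (1 + Real.log K) ≤ M * (11 * v * W) := by gcongr
    _ = (11 * M) * v * W := by ring
    _ ≤ v * v * W := by gcongr
    _ = v ^ 2 * W * (ε ^ 2 * E ^ 2) := by rw [hεE]; ring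
    _ = _ := by rw [hsqrt]; ring

/-! ### Expectation at an independent uniform index. -/

section UniformIndex

variable {Ω : Type*} [MeasurableSpace Ω] {μ : Measure Ω} {K : ℕ}
  {kHat : Ω → ℕ}

theorem measurable_random_index {E : Type*} [MeasurableSpace E] (hm : Measurable kHat)
    {F : ℕ → Ω → E} (hF : ∀ k, Measurable (F k)) : Measurable fun ω => F (kHat ω) ω := by
  have h1 : Measurable fun q : ℕ × Ω => F q.1 q.2 := measurable_from_prod_countable_right hF
  exact h1.comp (hm.prodMk measurable_id)

theorem measure_uniform_eq (hm : Measurable kHat) (hunif : μ.map kHat = uniformOn (Set.Icc 1 K))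
    {k : ℕ} (hk : k ∈ Finset.Icc 1 K) : μ.real (kHat ⁻¹' {k}) = 1 / K := by
  rw [measureReal_def, ← Measure.map_apply hm (measurableSet_singleton k), hunif, uniformOn,
    cond_apply measurableSet_Icc, Set.inter_singleton_of_mem (by simpa using hk),
    Measure.count_singleton, mul_one, ← Finset.coe_Icc, Measure.count_apply_finset]
  simp

theorem ae_uniform_mem (hm : Measurable kHat)
    (hunif : μ.map kHat = uniformOn (Set.Icc 1 K)) : ∀ᵐ ω ∂μ, kHat ω ∈ Finset.Icc 1 K := by
  have h1 : ∀ᵐ k ∂(μ.map kHat), k ∈ Set.Icc 1 K := by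
    rw [hunif, ae_iff]
    change uniformOn (Set.Icc 1 K) (Set.Icc 1 K)ᶜ = 0
    rw [uniformOn_eq_zero_iff (Set.finite_Icc 1 K)]
    simp
  filter_upwards [ae_of_ae_map hm.aemeasurable h1] with ω hω
  simpa using hω

/-- The expectation at an independent uniform index is the average of the expectations. -/
theorem integral_uniform_index [IsProbabilityMeasure μ] (hm : Measurable kHat)
    (hunif : μ.map kHat = uniformOn (Set.Icc 1 K)) {φ : ℕ → Ω → ℝ}
    (hφ : ∀ k, 1 ≤ k → Integrable (φ k) μ) (hind : ∀ k, 1 ≤ k → IndepFun kHat (φ k) μ) :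
    Integrable (fun ω => φ (kHat ω) ω) μ ∧
      ∫ ω, φ (kHat ω) ω ∂μ = 1 / K * ∑ k ∈ Finset.Icc 1 K, ∫ ω, φ k ω ∂μ := by
  let I : ℕ → Ω → ℝ := fun k ω => (if kHat ω = k then 1 else 0)
  have hI : ∀ k, I k = (kHat ⁻¹' {k}).indicator 1 := fun k => by
    classical
    funext ω
    simp [I, Set.indicator_apply]
  have hmI : ∀ k, MeasurableSet (kHat ⁻¹' {k}) := fun k => hm (measurableSet_singleton k)
  have hIi : ∀ k, Integrable (I k) μ := fun k => by
    rw [hI]; exact (integrable_const (1 : ℝ)).indicator (hmI k)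
  have hindI : ∀ k, 1 ≤ k → IndepFun (I k) (φ k) μ := fun k hk =>
    (hind k hk).comp (φ := fun j : ℕ => if j = k then (1 : ℝ) else 0) (ψ := id)
      (measurable_of_countable _) measurable_id
  have hprod : ∀ k, 1 ≤ k → Integrable (fun ω => I k ω * φ k ω) μ := fun k hk =>
    (hindI k hk).integrable_mul (hIi k) (hφ k hk)
  -- Expanding over the events `kHat = k` reduces the claim to products of independent factors.
  have hae : (fun ω => φ (kHat ω) ω) =ᵐ[μ] fun ω => ∑ k ∈ Finset.Icc 1 K, I k ω * φ k ω := by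
    filter_upwards [ae_uniform_mem hm hunif] with ω hω
    simp only [I, ite_mul, one_mul, zero_mul]
    rw [Finset.sum_ite_eq, if_pos hω]
  have hsum : Integrable (fun ω => ∑ k ∈ Finset.Icc 1 K, I k ω * φ k ω) μ :=
    integrable_finsetSum _ fun k hk => hprod k (Finset.mem_Icc.1 hk).1
  refine ⟨hsum.congr hae.symm, ?_⟩
  rw [integral_congr_ae hae, integral_finsetSum _ fun k hk => hprod k (Finset.mem_Icc.1 hk).1,
    Finset.mul_sum]
  refine Finset.sum_congr rfl fun k hk => ?_
  have hk1 := (Finset.mem_Icc.1 hk).1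
  rw [(hindI k hk1).integral_fun_mul_eq_mul_integral (hIi k).1 (hφ k hk1).1, hI,
    integral_indicator_one (hmI k), measure_uniform_eq hm hunif hk]

end UniformIndex

/-! ### Stationarity of the randomly chosen iterate. -/

namespace Problem

variable {d m : ℕ} {Ξ : Type*} [MeasurableSpace Ξ] {p : Problem d m Ξ} {κ : Constants}
  {Ω : Type*} [MeasurableSpace Ω] {μ : Measure Ω} {ξ : ℕ → Ω → Ξ} {ρ : ℝ} {x₁ : Vec d}

theorem gradient_add_jacT_smul (r : ℝ) (x : Vec d) :
    gradient p.f x + p.jacT x (r • p.c x) = p.gradQ r x := by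
  rw [gradQ, jacT, jacT, Finset.smul_sum]
  congr 1
  refine Finset.sum_congr rfl fun i _ => ?_
  rw [PiLp.smul_apply, smul_eq_mul, mul_smul]

namespace Assumptions

/-- A measurable function of an iterate is independent of whatever is independent of the
samples. -/
theorem indepFun_iterate (h : p.Assumptions κ) (hx₁ : x₁ ∈ p.X) {kHat : Ω → ℕ}
    -- The sample sequence starts at index `0` here, hence the shift `j - 1`; at `j = 0` it repeats
    -- a sample, which the iterates from `x_1` on never see.
    (hind : IndepFun kHat (fun ω k => ξ (k + 1) ω) μ) {k : ℕ} (hk : 1 ≤ k) {F : Vec d → ℝ}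
    (hF : Measurable fun z : ℕ → Ξ => F (iterate p κ ρ x₁ (fun j => z (j - 1)) k)) :
    IndepFun kHat (fun ω => F (iterate p κ ρ x₁ (fun j => ξ j ω) k)) μ := by
  have h1 := hind.comp measurable_id hF
  have he : (fun ω => F (iterate p κ ρ x₁ (fun j => ξ j ω) k))
      = (fun z : ℕ → Ξ => F (iterate p κ ρ x₁ (fun j => z (j - 1)) k))
        ∘ fun ω k => ξ (k + 1) ω := by
    funext ω
    refine congrArg F (h.iterate_congr ρ hx₁ (fun j hj => ?_) hk)
    simp only [Nat.sub_add_cancel hj]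
  rw [he]
  exact h1

theorem integrable_statGap [IsProbabilityMeasure μ] (h : p.Assumptions κ)
    (hs : p.IsSample μ ξ) (hL : 0 < κ.Ltilde m) (hρ : 1 < ρ) (hx₁ : x₁ ∈ p.X)
    (hI : p.IterateAssumptions κ μ fun k ω => iterate p κ ρ x₁ (fun j => ξ j ω) k)
    {k : ℕ} (hk : 1 ≤ k) :
    Integrable (fun ω =>
      p.statGap (penalty ρ k) (iterate p κ ρ x₁ (fun j => ξ j ω) (k + 1))) μ := by
  have h1 := (h.integrable_step_statGap hs hL hρ hx₁ hI hk
    (h.memLp_gradErr hs hL hρ hx₁ hI hk)).2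
  refine MemLp.integrable (q := 2) (by norm_num) ((memLp_two_iff_integrable_sq ?_).2 h1)
  exact (h.measurable_statGap hs.measurable ρ hx₁ (by omega) _).aestronglyMeasurable

theorem average_statGap_le [IsProbabilityMeasure μ] (h : p.Assumptions κ)
    (hs : p.IsSample μ ξ) (hL : 0 < κ.Ltilde m) (hρ : 1 < ρ) (hx₁ : x₁ ∈ p.X)
    (hI : p.IterateAssumptions κ μ fun k ω => iterate p κ ρ x₁ (fun j => ξ j ω) k)
    {K : ℕ} (hK : 1 ≤ K) {a : ℝ} (ha : 0 < a)
    (haK : κ.rate m ρ * (1 + Real.log K) ≤ a ^ 2 * √K) :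
    1 / K * ∑ k ∈ Finset.Icc 1 K,
      ∫ ω, p.statGap (penalty ρ k) (iterate p κ ρ x₁ (fun j => ξ j ω) (k + 1)) ∂μ ≤ a := by
  have hK' : (0 : ℝ) < K := by exact_mod_cast hK
  have h1 : ∀ k ∈ Finset.Icc 1 K,
      ∫ ω, p.statGap (penalty ρ k) (iterate p κ ρ x₁ (fun j => ξ j ω) (k + 1)) ∂μ
      ≤ a / 2 + 1 / (2 * a) *
        ∫ ω, p.statGap (penalty ρ k) (iterate p κ ρ x₁ (fun j => ξ j ω) (k + 1)) ^ 2 ∂μ := by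
    intro k hk
    have hk1 := (Finset.mem_Icc.1 hk).1
    have hi := (h.integrable_step_statGap hs hL hρ hx₁ hI hk1
      (h.memLp_gradErr hs hL hρ hx₁ hI hk1)).2.const_mul (1 / (2 * a))
    have h2 : ∫ ω, p.statGap (penalty ρ k) (iterate p κ ρ x₁ (fun j => ξ j ω) (k + 1)) ∂μ
        ≤ ∫ ω, (a / 2 + 1 / (2 * a) *
          p.statGap (penalty ρ k) (iterate p κ ρ x₁ (fun j => ξ j ω) (k + 1)) ^ 2) ∂μ := by
      refine integral_mono (h.integrable_statGap hs hL hρ hx₁ hI hk1)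
        ((integrable_const _).add hi) fun ω => ?_
      set s := p.statGap (penalty ρ k) (iterate p κ ρ x₁ (fun j => ξ j ω) (k + 1))
      -- The pointwise bound `s ≤ a/2 + s²/(2a)` takes the place of Jensen's inequality.
      have : a / 2 + 1 / (2 * a) * s ^ 2 - s = (s - a) ^ 2 / (2 * a) := by field_simp; ring
      have h0 : 0 ≤ (s - a) ^ 2 / (2 * a) := by positivity
      linarith
    rw [integral_add (integrable_const _) hi, integral_const_mul] at h2
    simpa using h2
  have h2 := Finset.sum_le_sum h1
  rw [Finset.sum_add_distrib, ← Finset.mul_sum] at h2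
  have h3 := h.sum_integral_statGap_sq_le hs hL hρ hx₁ hI hK
  have h4 : κ.rate m ρ * (1 + Real.log K) * √K ≤ a ^ 2 * K := by
    calc κ.rate m ρ * (1 + Real.log K) * √K ≤ a ^ 2 * √K * √K := by gcongr
      _ = _ := by rw [mul_assoc, Real.mul_self_sqrt hK'.le]
  have h5 := mul_le_mul_of_nonneg_left (h3.trans h4) (by positivity : 0 ≤ 1 / (2 * a))
  have h6 : 1 / (2 * a) * (a ^ 2 * K) = a / 2 * K := by field_simp
  simp only [Finset.sum_const, Nat.card_Icc, Nat.add_sub_cancel, nsmul_eq_mul] at h2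
  rw [one_div_mul_eq_div, div_le_iff₀ hK']
  linarith

/-- Half of `ε` comes from the average gap divided by `δ`, the other half from `(C_{∇f}/δ) ∑
k^{-1/4} ≤ 2 (C_{∇f}/δ) K^{3/4}`. -/
theorem average_norm_c_le [IsProbabilityMeasure μ] (h : p.Assumptions κ)
    (hs : p.IsSample μ ξ) (hL : 0 < κ.Ltilde m) (hρ : 1 < ρ) (hx₁ : x₁ ∈ p.X)
    (hI : p.IterateAssumptions κ μ fun k ω => iterate p κ ρ x₁ (fun j => ξ j ω) k)
    {K : ℕ} (hK : 1 ≤ K) {ε : ℝ} (hεK : 4 * κ.Cgf / κ.δ ≤ ε * (K : ℝ) ^ (1 / 4 : ℝ))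
    (hi : ∀ k, 1 ≤ k → Integrable (fun ω => ‖p.c (iterate p κ ρ x₁ (fun j => ξ j ω) (k + 1))‖) μ)
    (hstat : 1 / K * ∑ k ∈ Finset.Icc 1 K,
      ∫ ω, p.statGap (penalty ρ k) (iterate p κ ρ x₁ (fun j => ξ j ω) (k + 1)) ∂μ
        ≤ κ.δ / 2 * ε) :
    1 / K * ∑ k ∈ Finset.Icc 1 K,
      ∫ ω, ‖p.c (iterate p κ ρ x₁ (fun j => ξ j ω) (k + 1))‖ ∂μ ≤ ε := by
  have hδ := κ.δ_pos
  have hC := κ.Cgf_nonneg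
  have hK' : (0 : ℝ) < K := by exact_mod_cast hK
  have h1 : ∀ k ∈ Finset.Icc 1 K,
      ∫ ω, ‖p.c (iterate p κ ρ x₁ (fun j => ξ j ω) (k + 1))‖ ∂μ
      ≤ 1 / κ.δ * ∫ ω, p.statGap (penalty ρ k) (iterate p κ ρ x₁ (fun j => ξ j ω) (k + 1)) ∂μ
        + κ.Cgf / κ.δ * (1 / (k : ℝ) ^ (1 / 4 : ℝ)) := by
    intro k hk
    have hk1 := (Finset.mem_Icc.1 hk).1
    have hg := (h.integrable_statGap hs hL hρ hx₁ hI hk1).const_mul (1 / κ.δ)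
    have h2 : ∫ ω, ‖p.c (iterate p κ ρ x₁ (fun j => ξ j ω) (k + 1))‖ ∂μ
        ≤ ∫ ω, (1 / κ.δ * p.statGap (penalty ρ k) (iterate p κ ρ x₁ (fun j => ξ j ω) (k + 1))
          + κ.Cgf / κ.δ * (1 / (k : ℝ) ^ (1 / 4 : ℝ))) ∂μ := by
      refine integral_mono_ae (hi k hk1) (hg.add (integrable_const _)) ?_
      filter_upwards [hI.regular (k + 1) (by omega)] with ω hreg
      have hr := one_le_penalty hρ hk1
      have hb := h.mul_norm_c_le (h.iterate_mem ρ hx₁ (fun j => ξ j ω) (k + 1))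
        (zero_lt_one.trans_le hr) hreg
      have h0 := p.statGap_nonneg (penalty ρ k) (iterate p κ ρ x₁ (fun j => ξ j ω) (k + 1))
      set s := p.statGap (penalty ρ k) (iterate p κ ρ x₁ (fun j => ξ j ω) (k + 1))
      have ht := one_le_rpow_quarter hk1
      have hrt : (k : ℝ) ^ (1 / 4 : ℝ) ≤ penalty ρ k := by
        rw [penalty]; exact le_mul_of_one_le_left (by linarith) hρ.le
      set t := (k : ℝ) ^ (1 / 4 : ℝ)
      have hb' : κ.δ * t * ‖p.c (iterate p κ ρ x₁ (fun j => ξ j ω) (k + 1))‖ ≤ s + κ.Cgf :=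
        le_trans (by gcongr) hb
      calc ‖p.c (iterate p κ ρ x₁ (fun j => ξ j ω) (k + 1))‖
          = (κ.δ * t * ‖p.c (iterate p κ ρ x₁ (fun j => ξ j ω) (k + 1))‖) / (κ.δ * t) := by
            field_simp
        _ ≤ (s + κ.Cgf) / (κ.δ * t) := by gcongr
        _ = s / (κ.δ * t) + κ.Cgf / κ.δ * (1 / t) := by field_simp
        _ ≤ s / κ.δ + κ.Cgf / κ.δ * (1 / t) := by
            gcongr
            exact le_mul_of_one_le_right hδ.le ht
        _ = _ := by ring
    rw [integral_add hg (integrable_const _), integral_const_mul] at h2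
    simpa using h2
  have h2 := Finset.sum_le_sum h1
  rw [Finset.sum_add_distrib, ← Finset.mul_sum, ← Finset.mul_sum] at h2
  have h3 := mul_le_mul_of_nonneg_left (sum_inv_rpow_quarter_le K)
    (by positivity : 0 ≤ κ.Cgf / κ.δ)
  have h4 := rpow_quarter_pow_four K
  have ht := one_le_rpow_quarter hK
  set t := (K : ℝ) ^ (1 / 4 : ℝ)
  rw [one_div_mul_eq_div, div_le_iff₀ hK'] at hstat ⊢
  have h5 := mul_le_mul_of_nonneg_left hstat (by positivity : 0 ≤ 1 / κ.δ)
  have h6 : 1 / κ.δ * (κ.δ / 2 * ε * K) = ε / 2 * K := by field_simp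
  have h7 : κ.Cgf / κ.δ * (2 * t ^ 3) ≤ ε / 2 * K := by
    calc κ.Cgf / κ.δ * (2 * t ^ 3) = 4 * κ.Cgf / κ.δ * (t ^ 3 / 2) := by ring
      _ ≤ ε * t * (t ^ 3 / 2) := by gcongr
      _ = ε / 2 * t ^ 4 := by ring
      _ = _ := by rw [h4]
  linarith

theorem measurable_multiplier (h : p.Assumptions κ) (hξ : ∀ k, 1 ≤ k → Measurable (ξ k))
    (hx₁ : x₁ ∈ p.X) {kHat : Ω → ℕ} (hm : Measurable kHat) :
    Measurable fun ω => penalty ρ (kHat ω) •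
      p.c (iterate p κ ρ x₁ (fun j => ξ j ω) (kHat ω + 1)) := by
  refine measurable_random_index hm (F := fun k ω => penalty ρ k •
    p.c (iterate p κ ρ x₁ (fun j => ξ j ω) (k + 1))) fun k => ?_
  have h1 : Measurable fun ω => p.c (iterate p κ ρ x₁ (fun j => ξ j ω) (k + 1)) :=
    h.measurable_c.comp (h.measurable_iterate hξ ρ hx₁ (by omega))
  exact h1.const_smul (penalty ρ k)

theorem isExpectedStationary [IsProbabilityMeasure μ] (h : p.Assumptions κ)
    (hs : p.IsSample μ ξ) (hL : 0 < κ.Ltilde m) (hρ : 1 < ρ) (hx₁ : x₁ ∈ p.X)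
    (hI : p.IterateAssumptions κ μ fun k ω => iterate p κ ρ x₁ (fun j => ξ j ω) k)
    {K : ℕ} (hK : 1 ≤ K) {ε : ℝ} (hε : 0 < ε)
    (hrate : κ.rate m ρ * (1 + Real.log K) ≤ (min 1 (κ.δ / 2) * ε) ^ 2 * √K)
    (hεK : 4 * κ.Cgf / κ.δ ≤ ε * (K : ℝ) ^ (1 / 4 : ℝ))
    {kHat : Ω → ℕ} (hm : Measurable kHat) (hunif : μ.map kHat = uniformOn (Set.Icc 1 K))
    (hind : IndepFun kHat (fun ω k => ξ (k + 1) ω) μ) :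
    p.IsExpectedStationary μ ε
      (fun ω => iterate p κ ρ x₁ (fun j => ξ j ω) (kHat ω + 1)) := by
  have hshift : ∀ k, 1 ≤ k → Measurable fun z : ℕ → Ξ => z (k - 1) := fun k _ =>
    measurable_pi_apply _
  have hδ := κ.δ_pos
  have hmin : 0 < min 1 (κ.δ / 2) := lt_min one_pos (by linarith)
  -- The target `min 1 (δ/2) · ε` serves both conclusions: at most `ε` for stationarity, at most
  -- `δε/2` for feasibility.
  have havg := h.average_statGap_le hs hL hρ hx₁ hI hK (mul_pos hmin hε) hrate
  have hci : ∀ k, 1 ≤ k →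
      Integrable (fun ω => ‖p.c (iterate p κ ρ x₁ (fun j => ξ j ω) (k + 1))‖) μ := fun k _ => by
    refine Integrable.mono' (integrable_const √(m * κ.Cc ^ 2)) (h.measurable_c.comp
      (h.measurable_iterate hs.measurable ρ hx₁ (by omega))).norm.aestronglyMeasurable
      (ae_of_all _ fun ω => ?_)
    rw [norm_norm]
    exact Real.le_sqrt_of_sq_le (h.norm_c_sq_le (h.iterate_mem ρ hx₁ _ _))
  have hstat := integral_uniform_index hm hunif
    (φ := fun k ω => p.statGap (penalty ρ k) (iterate p κ ρ x₁ (fun j => ξ j ω) (k + 1)))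
    (fun k hk => h.integrable_statGap hs hL hρ hx₁ hI hk)
    (fun k _ => h.indepFun_iterate hx₁ hind (by omega)
      (h.measurable_statGap (ξ := fun j (z : ℕ → Ξ) => z (j - 1)) hshift ρ hx₁ (by omega) _))
  have hc := integral_uniform_index hm hunif
    (φ := fun k ω => ‖p.c (iterate p κ ρ x₁ (fun j => ξ j ω) (k + 1))‖) hci
    (fun k _ => h.indepFun_iterate (F := fun x => ‖p.c x‖) hx₁ hind (by omega)
      (h.measurable_c.comp (h.measurable_iterate (ξ := fun j (z : ℕ → Ξ) => z (j - 1))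
        hshift ρ hx₁ (by omega))).norm)
  refine ⟨fun ω => h.iterate_mem ρ hx₁ _ _, ⟨fun ω => penalty ρ (kHat ω) •
    p.c (iterate p κ ρ x₁ (fun j => ξ j ω) (kHat ω + 1)), ?_, ?_⟩, hc.1, ?_⟩
  · exact h.measurable_multiplier hs.measurable hx₁ hm
  · simp only [gradient_add_jacT_smul]
    refine ⟨hstat.1, hstat.2.trans_le (havg.trans ?_)⟩
    exact mul_le_of_le_one_left hε.le (min_le_left _ _)
  · refine hc.2.trans_le (h.average_norm_c_le hs hL hρ hx₁ hI hK hεK hci (havg.trans ?_))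
    gcongr
    exact min_le_right _ _

end Assumptions

end Problem

end StochPenalty

theorem mainTheorem3 (m : ℕ) (κ : StochPenalty.Constants) (hL : 0 < κ.Ltilde m)
    (ρ : ℝ) (hρ : 1 < ρ) :
    ∃ (C : ℝ) (q : ℕ),
      -- the constants of the bound depend only on `m`, `κ`, `ρ`
      ∀ (d : ℕ) (Ξ : Type*) [MeasurableSpace Ξ] (p : StochPenalty.Problem d m Ξ),
      p.Assumptions κ →
      ∀ (x₁ : StochPenalty.Vec d), x₁ ∈ p.X →
      -- i.i.d. samples `ξ 1, ξ 2, …` with law `P`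
      ∀ (Ω : Type*) [MeasurableSpace Ω] (μ : Measure Ω) [IsProbabilityMeasure μ]
        (ξ : ℕ → Ω → Ξ), (∀ k, 1 ≤ k → Measurable (ξ k)) →
      (∀ k, 1 ≤ k → μ.map (ξ k) = p.P) →
      iIndepFun (fun k => ξ (k + 1)) μ →
      p.IterateAssumptions κ μ
        (fun k ω => StochPenalty.iterate p κ ρ x₁ (fun j => ξ j ω) k) →
      ∀ ε : ℝ, 0 < ε → ε ≤ 1 →
      ∃ K₀ : ℕ, 1 ≤ K₀ ∧ (K₀ : ℝ) ≤ C * (1 / ε) ^ 4 * (1 + Real.log (1 / ε)) ^ q ∧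
        ∀ K : ℕ, K₀ ≤ K →
        -- `kHat` is uniform on `{1, …, K}` and independent of the samples
        ∀ kHat : Ω → ℕ, Measurable kHat → μ.map kHat = uniformOn (Set.Icc 1 K) →
        IndepFun kHat (fun ω k => ξ (k + 1) ω) μ →
        p.IsExpectedStationary μ ε
          (fun ω => StochPenalty.iterate p κ ρ x₁ (fun j => ξ j ω) (kHat ω + 1)) := by
  have hδ := κ.δ_pos
  have hmin : 0 < min 1 (κ.δ / 2) := lt_min one_pos (by linarith)
  have hrate : 0 ≤ κ.rate m ρ := by
    have h1 := κ.range_nonneg hL hρ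
    have h2 := κ.drift_nonneg hL hρ
    rw [StochPenalty.Constants.rate]; positivity
  obtain ⟨C, hC1, hC⟩ := StochPenalty.exists_threshold
    -- The first summand of `M` gives the rate condition. The second gives `4 C_{∇f}/δ ≤ ε K^{1/4}`
    -- after squaring, since `1 + log K ≥ 1`.
    (M := κ.rate m ρ / min 1 (κ.δ / 2) ^ 2 + (4 * κ.Cgf / κ.δ) ^ 2) (by positivity)
  -- The extra `1` absorbs the rounding up of the threshold to an integer.
  refine ⟨C + 1, 2, ?_⟩
  intro d Ξ _ p h x₁ hx₁ Ω _ μ _ ξ hξm hξP hξi hI ε hε hε1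
  have hE : 1 ≤ 1 / ε := by rw [le_div_iff₀ hε]; linarith
  have hW : 1 ≤ 1 + Real.log (1 / ε) := by linarith [Real.log_nonneg hE]
  have hEW : 1 ≤ (1 / ε) ^ 4 * (1 + Real.log (1 / ε)) ^ 2 :=
    one_le_mul_of_one_le_of_one_le (one_le_pow₀ hE) (one_le_pow₀ hW)
  have hpos : 0 < C * (1 / ε) ^ 4 * (1 + Real.log (1 / ε)) ^ 2 := by positivity
  refine ⟨⌈C * (1 / ε) ^ 4 * (1 + Real.log (1 / ε)) ^ 2⌉₊, Nat.one_le_ceil_iff.2 hpos, ?_, ?_⟩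
  · refine (Nat.ceil_lt_add_one hpos.le).le.trans ?_
    linarith
  intro K hK kHat hm hunif hind
  have hKC := hC ε hε hε1 K (Nat.ceil_le.1 hK)
  have hK1 : 1 ≤ K := (Nat.one_le_ceil_iff.2 hpos).trans hK
  have hlog : 0 ≤ Real.log K := Real.log_nonneg (by exact_mod_cast hK1)
  refine h.isExpectedStationary ⟨hξm, hξP, hξi⟩ hL hρ hx₁ hI hK1 hε ?_ ?_ hm hunif hind
  · have h1 : κ.rate m ρ / min 1 (κ.δ / 2) ^ 2 * (1 + Real.log K) ≤ ε ^ 2 * √K := by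
      refine le_trans ?_ hKC
      gcongr
      exact le_add_of_nonneg_right (sq_nonneg _)
    calc κ.rate m ρ * (1 + Real.log K)
        = min 1 (κ.δ / 2) ^ 2 * (κ.rate m ρ / min 1 (κ.δ / 2) ^ 2 * (1 + Real.log K)) := by
          field_simp
      _ ≤ min 1 (κ.δ / 2) ^ 2 * (ε ^ 2 * √K) := by gcongr
      _ = _ := by ring
  · refine le_of_sq_le_sq ?_ (by positivity)
    rw [mul_pow, ← StochPenalty.rpow_half_eq_sq, ← Real.sqrt_eq_rpow]
    refine le_trans ?_ hKC
    calc (4 * κ.Cgf / κ.δ) ^ 2 ≤ (κ.rate m ρ / min 1 (κ.δ / 2) ^ 2 + (4 * κ.Cgf / κ.δ) ^ 2) * 1 := by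
          rw [mul_one]; exact le_add_of_nonneg_left (by positivity)
      _ ≤ _ := by gcongr; linarith
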